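/- Let $1/10 < H < 1/2$ and let $B = \{B_t,\ t \ge 0\}$ be a fractional Brownian motion with Hurst parameter $H$ on a probability space $(\Omega,\mathcal F,\mathbb P)$, that is, a centered Gaussian process with $$\mathbb E[B_sB_t] = \tfrac12\left(s^{2H} + t^{2H} - |t-s|^{2H}\right), \qquad s,t \ge 0.$$ Let $g \in C^\infty(\mathbb R)$ be real-valued and such that $g$ and each of its derivatives have moderate growth, where a function $f:\mathbb R\to\mathbb R$ has moderate growth if there are constants $A$, $b$ and $\alpha<2$ (depending on $f$) such that $|f(x)| \le A e^{b|x|^\alpha}$ for all $x \in \mathbb R$. For $n \ge 1$ and $j \ge 0$ put $\Delta B_{j/n} = B_{(j+1)/n} - B_{j/n}$ and $\widetilde B_{j/n} = \frac12\left(B_{j/n} + B_{(j+1)/n}\right)$. Then for every $t \ge 0$ the Simpson's rule Riemann sums $$\sum_{j=0}^{\lfloor nt\rfloor - 1} \frac16\left(g'(B_{j/n}) + 4g'(\widetilde B_{j/n}) + g'(B_{(j+1)/n})\right)\Delta B_{j/n}$$ converge in probability, as $n\to\infty$, to $g(B_t) - g(0)$. -/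

import Mathlib

open MeasureTheory ProbabilityTheory Filter
open scoped NNReal

/-- `f` satisfies moderate growth conditions: there are constants `A`, `b` and `α < 2` with
`|f x| ≤ A * exp (b * |x| ^ α)` for every real `x`. -/
def ModerateGrowth (f : ℝ → ℝ) : Prop :=
  ∃ A b α : ℝ, α < 2 ∧ ∀ x : ℝ, |f x| ≤ A * Real.exp (b * |x| ^ α)

/-- `B`, indexed by times `t ≥ 0`, is a fractional Brownian motion with Hurst parameter `H`
under `P`: a centered Gaussian process with covariance
`E[B_s B_t] = (s ^ (2H) + t ^ (2H) - |t - s| ^ (2H)) / 2`.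
(`IsGaussianProcess` forces `P` to be a probability measure.) -/
structure IsFractionalBrownianMotion {Ω : Type*} [MeasurableSpace Ω] (H : ℝ)
    (B : ℝ≥0 → Ω → ℝ) (P : Measure Ω) : Prop where
  isGaussianProcess : IsGaussianProcess B P
  centered : ∀ t : ℝ≥0, ∫ ω, B t ω ∂P = 0
  covariance : ∀ s t : ℝ≥0, ∫ ω, B s ω * B t ω ∂P =
    (1 / 2) * ((s : ℝ) ^ (2 * H) + (t : ℝ) ^ (2 * H) - |(t : ℝ) - (s : ℝ)| ^ (2 * H))

/-- The Simpson's rule Riemann sum of `g'` along the path `b` on `[0, t]`, for the uniform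
partition of mesh `1 / n`. -/
noncomputable def simpsonSum (g : ℝ → ℝ) (b : ℝ≥0 → ℝ) (t : ℝ≥0) (n : ℕ) : ℝ :=
  ∑ j ∈ Finset.range ⌊(n : ℝ≥0) * t⌋₊,
    (1 / 6) *
      (deriv g (b ((j : ℝ≥0) / n)) +
        4 * deriv g ((1 / 2) * (b ((j : ℝ≥0) / n) + b (((j : ℝ≥0) + 1) / n))) +
        deriv g (b (((j : ℝ≥0) + 1) / n))) *
      (b (((j : ℝ≥0) + 1) / n) - b ((j : ℝ≥0) / n))

/-! Expand one Simpson step at its midpoint value. By symmetry only odd derivatives of `g` survive,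
and the third-order term cancels because Simpson's rule is exact on cubics. Hence a step equals the
increment of `g` along it, plus explicit terms in `ΔB ^ 5`, `ΔB ^ 7`, `ΔB ^ 9` with derivatives of
`g` at the midpoint, plus a remainder of size `|ΔB| ^ 10` (`abs_simpson_error_le`). The increments
of `g` telescope to `g (B_{N/n}) - g 0`, where `N = ⌊n t⌋`; the missing last piece up to `t` is of
order `n ^ (-H)` in mean.

The remainders add up to order `n * n ^ (-10 H)` in mean, which vanishes exactly when `H > 1/10`.
Absolute values would not suffice for the odd powers: there cancellation is needed, and it is
obtained in mean square (`exists_oddSum_bound`). Stein's identity (`stein_identity`) shows that a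
moment with odd powers of two normalized increments is bounded by their correlation, plus products
of covariances of increments with midpoints (`exists_bound_of_odd_of_odd`). Since `m ↦ m ^ (2 H)` is
concave for `H ≤ 1/2`, these quantities telescope, and their double sum is only of order `n`
(`IsConcaveWeight.sum_sum_le`). So the sum of `p`-th powers has second moment of order `n * n ^ (-2
p H)`, and `p = 5` gives the same threshold. The total error thus tends to zero in mean, hence in
probability. -/

/-! ### Exponential and weighted moments of Gaussian variables. -/

/-- `E[exp (Z ^ 2 / 4)]` for a standard Gaussian variable `Z`. -/
noncomputable def gaussianExpSq : ℝ := ∫ x, Real.exp (x ^ 2 / 4) ∂(gaussianReal 0 1)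

theorem integrable_gaussianReal_iff {f : ℝ → ℝ} :
    Integrable f (gaussianReal 0 1) ↔ Integrable (fun x => gaussianPDFReal 0 1 x * f x) := by
  rw [gaussianReal_of_var_ne_zero _ one_ne_zero,
    integrable_withDensity_iff_integrable_smul' (measurable_gaussianPDF _ _)
      (ae_of_all _ fun _ => gaussianPDF_lt_top)]
  simp [smul_eq_mul]

theorem integrable_exp_sq_div_four :
    Integrable (fun x : ℝ => Real.exp (x ^ 2 / 4)) (gaussianReal 0 1) := by
  rw [integrable_gaussianReal_iff]
  have h := (integrable_exp_neg_mul_sq (b := 1 / 4) (by norm_num)).const_mul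
    (√(2 * Real.pi * ((1 : ℝ≥0) : ℝ)))⁻¹
  refine h.congr (ae_of_all _ fun x => ?_)
  simp only [gaussianPDFReal_def]
  rw [mul_assoc _ (Real.exp _) (Real.exp _), ← Real.exp_add]
  congr 2
  push_cast
  ring

theorem gaussianExpSq_nonneg : 0 ≤ gaussianExpSq := integral_nonneg fun _ => (Real.exp_pos _).le

section Moments

variable {Ω : Type*} [MeasurableSpace Ω] {P : Measure Ω}

theorem map_centered_eq {X : Ω → ℝ} (hX : HasGaussianLaw X P) (h0 : ∫ ω, X ω ∂P = 0) :
    P.map X = (gaussianReal 0 1).map (fun z => √(Var[X; P]) * z) := by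
  rw [hX.map_eq_gaussianReal, h0, gaussianReal_map_const_mul]
  congr 1
  · simp
  · ext
    simp [variance_nonneg, Real.sq_sqrt]

/-- In law `X` is `√Var[X]` times a standard variable `Z`, so `l * X ^ 2` becomes at most `Z ^ 2 /
4`. The bound is uniform in `X`, and degenerate variables are included. -/
theorem exp_sq_integrable_and_le {X : Ω → ℝ} (hX : HasGaussianLaw X P) (h0 : ∫ ω, X ω ∂P = 0)
    {l : ℝ} (hl : l * Var[X; P] ≤ 1 / 4) :
    Integrable (fun ω => Real.exp (l * X ω ^ 2)) P ∧
      ∫ ω, Real.exp (l * X ω ^ 2) ∂P ≤ gaussianExpSq := by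
  have hm : Measurable (fun x : ℝ => Real.exp (l * x ^ 2)) := by fun_prop
  have hs : Measurable (fun z : ℝ => √(Var[X; P]) * z) := by fun_prop
  have hb : ∀ z : ℝ, Real.exp (l * (√(Var[X; P]) * z) ^ 2) ≤ Real.exp (z ^ 2 / 4) := by
    intro z
    apply Real.exp_le_exp.2
    rw [mul_pow, Real.sq_sqrt (variance_nonneg _ _)]
    nlinarith [sq_nonneg z]
  have hi : Integrable (fun z : ℝ => Real.exp (l * (√(Var[X; P]) * z) ^ 2)) (gaussianReal 0 1) :=
    integrable_exp_sq_div_four.mono' (hm.comp hs).aestronglyMeasurable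
      (ae_of_all _ fun z => by
        rw [Real.norm_eq_abs, abs_of_pos (Real.exp_pos _)]; exact hb z)
  have hi' : Integrable (fun x : ℝ => Real.exp (l * x ^ 2)) (P.map X) := by
    rw [map_centered_eq hX h0]
    exact (integrable_map_measure hm.aestronglyMeasurable hs.aemeasurable).2 hi
  refine ⟨(integrable_map_measure hm.aestronglyMeasurable hX.aemeasurable).1 hi', ?_⟩
  have : ∫ ω, Real.exp (l * X ω ^ 2) ∂P = ∫ x, Real.exp (l * x ^ 2) ∂(P.map X) :=
    (integral_map hX.aemeasurable hm.aestronglyMeasurable).symm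
  rw [this, map_centered_eq hX h0, integral_map hs.aemeasurable hm.aestronglyMeasurable]
  exact integral_mono hi integrable_exp_sq_div_four hb

theorem abs_pow_le_exp_sq (p : ℕ) (x : ℝ) :
    |x| ^ p ≤ (p.factorial * Real.exp 4) * Real.exp (x ^ 2 / 16) := by
  have h1 : |x| ^ p ≤ p.factorial * Real.exp |x| := by
    have := Real.pow_div_factorial_le_exp |x| (abs_nonneg x) p
    rwa [div_le_iff₀ (by positivity), mul_comm] at this
  have h2 : Real.exp |x| ≤ Real.exp 4 * Real.exp (x ^ 2 / 16) := by
    rw [← Real.exp_add]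
    apply Real.exp_le_exp.2
    rw [← sq_abs]
    -- The constant 4 comes from completing the square: `4 + x ^ 2 / 16 - |x| = (|x| - 8) ^ 2 / 16`.
    nlinarith [sq_nonneg (|x| - 8)]
  calc |x| ^ p ≤ p.factorial * Real.exp |x| := h1
    _ ≤ p.factorial * (Real.exp 4 * Real.exp (x ^ 2 / 16)) := by gcongr
    _ = _ := by ring

/-- A pointwise substitute for Hölder's inequality with four factors. -/
theorem mul_four_le_pow_four (a b c d : ℝ) : a * b * (c * d) ≤ a ^ 4 + b ^ 4 + c ^ 4 + d ^ 4 := by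
  nlinarith [sq_nonneg (a * b - c * d), sq_nonneg (a ^ 2 - b ^ 2), sq_nonneg (c ^ 2 - d ^ 2),
    sq_nonneg (a ^ 2), sq_nonneg (b ^ 2), sq_nonneg (c ^ 2), sq_nonneg (d ^ 2)]

/-- Uniform bound for mixed moments of centered Gaussian variables, weighted by functions of
sub-Gaussian growth. -/
theorem exists_moment_bound (P : Measure Ω) (p q : ℕ) {V : ℝ} (hV : 0 < V) {f h : ℝ → ℝ}
    (hfm : Measurable f)
    (hhm : Measurable h) (hf : ∃ C, ∀ x, |f x| ≤ C * Real.exp (x ^ 2 / (16 * V)))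
    (hh : ∃ C, ∀ x, |h x| ≤ C * Real.exp (x ^ 2 / (16 * V))) :
    ∃ C, 0 ≤ C ∧ ∀ X₁ X₂ Y₁ Y₂ : Ω → ℝ,
      HasGaussianLaw X₁ P → HasGaussianLaw X₂ P → HasGaussianLaw Y₁ P → HasGaussianLaw Y₂ P →
      ∫ ω, X₁ ω ∂P = 0 → ∫ ω, X₂ ω ∂P = 0 → ∫ ω, Y₁ ω ∂P = 0 → ∫ ω, Y₂ ω ∂P = 0 →
      Var[X₁; P] ≤ 1 → Var[X₂; P] ≤ 1 → Var[Y₁; P] ≤ V → Var[Y₂; P] ≤ V →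
      Integrable (fun ω => X₁ ω ^ p * X₂ ω ^ q * (f (Y₁ ω) * h (Y₂ ω))) P ∧
      ∫ ω, |X₁ ω ^ p * X₂ ω ^ q * (f (Y₁ ω) * h (Y₂ ω))| ∂P ≤ C := by
  obtain ⟨Cf, hCf⟩ := hf
  obtain ⟨Ch, hCh⟩ := hh
  have hCf0 : 0 ≤ Cf := by
    have := (abs_nonneg _).trans (hCf 0)
    simpa using this
  have hCh0 : 0 ≤ Ch := by
    have := (abs_nonneg _).trans (hCh 0)
    simpa using this
  set Kp : ℝ := p.factorial * Real.exp 4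
  set Kq : ℝ := q.factorial * Real.exp 4
  have hKp : 0 ≤ Kp := by positivity
  have hKq : 0 ≤ Kq := by positivity
  set C := Kp * Kq * (Cf * Ch)
  have hC : 0 ≤ C := by positivity
  refine ⟨C * (4 * gaussianExpSq), mul_nonneg hC (by linarith [gaussianExpSq_nonneg]), ?_⟩
  intro X₁ X₂ Y₁ Y₂ g1 g2 g3 g4 m1 m2 m3 m4 v1 v2 v3 v4
  have a1 := exp_sq_integrable_and_le g1 m1 (l := 1 / 4) (by linarith)
  have a2 := exp_sq_integrable_and_le g2 m2 (l := 1 / 4) (by linarith)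
  have hvv : ∀ v, v ≤ V → 1 / (4 * V) * v ≤ 1 / 4 := by
    intro v hv
    rw [div_mul_eq_mul_div, div_le_div_iff₀ (by positivity) (by norm_num)]
    linarith
  have a3 := exp_sq_integrable_and_le g3 m3 (hvv _ v3)
  have a4 := exp_sq_integrable_and_le g4 m4 (hvv _ v4)
  have hint := (((a1.1.add a2.1).add a3.1).add a4.1).const_mul C
  -- Each factor is dominated by an exponential with rate 1/16 relative to its variance bound. The
  -- fourth powers from `mul_four_le_pow_four` raise this to 1/4, the largest rate that
  -- `exp_sq_integrable_and_le` allows.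
  have hpt : ∀ ω, |X₁ ω ^ p * X₂ ω ^ q * (f (Y₁ ω) * h (Y₂ ω))| ≤
      C * (Real.exp (1 / 4 * X₁ ω ^ 2) + Real.exp (1 / 4 * X₂ ω ^ 2)
        + Real.exp (1 / (4 * V) * Y₁ ω ^ 2) + Real.exp (1 / (4 * V) * Y₂ ω ^ 2)) := by
    intro ω
    have e1 : ∀ x : ℝ, Real.exp (1 / 4 * x ^ 2) = Real.exp (x ^ 2 / 16) ^ 4 := by
      intro x
      rw [← Real.exp_nat_mul]; congr 1; push_cast; ring
    have e2 : ∀ x : ℝ, Real.exp (1 / (4 * V) * x ^ 2) = Real.exp (x ^ 2 / (16 * V)) ^ 4 := by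
      intro x
      rw [← Real.exp_nat_mul]; congr 1; push_cast; field_simp; ring
    rw [e1, e1, e2, e2, abs_mul, abs_mul, abs_mul, abs_pow, abs_pow]
    calc |X₁ ω| ^ p * |X₂ ω| ^ q * (|f (Y₁ ω)| * |h (Y₂ ω)|)
        ≤ (Kp * Real.exp (X₁ ω ^ 2 / 16)) * (Kq * Real.exp (X₂ ω ^ 2 / 16)) *
          ((Cf * Real.exp (Y₁ ω ^ 2 / (16 * V))) * (Ch * Real.exp (Y₂ ω ^ 2 / (16 * V)))) := by
          gcongr
          · exact abs_pow_le_exp_sq p _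
          · exact abs_pow_le_exp_sq q _
          · exact hCf _
          · exact hCh _
      _ = C * (Real.exp (X₁ ω ^ 2 / 16) * Real.exp (X₂ ω ^ 2 / 16) *
          (Real.exp (Y₁ ω ^ 2 / (16 * V)) * Real.exp (Y₂ ω ^ 2 / (16 * V)))) := by ring
      _ ≤ _ := by
          gcongr
          exact mul_four_le_pow_four _ _ _ _
  have hmeas : AEStronglyMeasurable (fun ω => X₁ ω ^ p * X₂ ω ^ q * (f (Y₁ ω) * h (Y₂ ω))) P :=
    (((g1.aemeasurable.pow_const p).mul (g2.aemeasurable.pow_const q)).mul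
      ((hfm.comp_aemeasurable g3.aemeasurable).mul
        (hhm.comp_aemeasurable g4.aemeasurable))).aestronglyMeasurable
  have hI : Integrable (fun ω => X₁ ω ^ p * X₂ ω ^ q * (f (Y₁ ω) * h (Y₂ ω))) P :=
    hint.mono' hmeas (ae_of_all _ hpt)
  refine ⟨hI, (integral_mono hI.abs hint hpt).trans ?_⟩
  rw [integral_const_mul]
  apply mul_le_mul_of_nonneg_left _ hC
  rw [integral_add' ((a1.1.add a2.1).add a3.1) a4.1, integral_add' (a1.1.add a2.1) a3.1,
    integral_add' a1.1 a2.1]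
  linarith [a1.2, a2.2, a3.2, a4.2]

end Moments

/-! ### Gaussian integration by parts and Stein's identity. -/

theorem hasDerivAt_gaussianPDFReal_std (x : ℝ) :
    HasDerivAt (gaussianPDFReal 0 1) (-(x * gaussianPDFReal 0 1 x)) x := by
  have h : HasDerivAt (fun y : ℝ => (√(2 * Real.pi * ((1 : ℝ≥0) : ℝ)))⁻¹ *
      Real.exp (-(y - 0) ^ 2 / (2 * ((1 : ℝ≥0) : ℝ))))
      ((√(2 * Real.pi * ((1 : ℝ≥0) : ℝ)))⁻¹ * (Real.exp (-(x - 0) ^ 2 / (2 * ((1 : ℝ≥0) : ℝ))) *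
        (-((2 : ℕ) * (x - 0) ^ (2 - 1) * 1) / (2 * ((1 : ℝ≥0) : ℝ))))) x :=
    ((((((hasDerivAt_id x).sub_const 0).pow 2).neg).div_const _).exp).const_mul _
  rw [gaussianPDFReal_def]
  convert! h using 1
  push_cast
  ring

/-- Gaussian integration by parts on the line. -/
theorem gaussian_integral_by_parts {φ φ' : ℝ → ℝ} (hd : ∀ x, HasDerivAt φ (φ' x) x)
    (h1 : Integrable φ (gaussianReal 0 1)) (h2 : Integrable (fun x => x * φ x) (gaussianReal 0 1))
    (h3 : Integrable φ' (gaussianReal 0 1)) :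
    ∫ x, x * φ x ∂(gaussianReal 0 1) = ∫ x, φ' x ∂(gaussianReal 0 1) := by
  rw [integrable_gaussianReal_iff] at h1 h2 h3
  rw [integral_gaussianReal_eq_integral_smul one_ne_zero,
    integral_gaussianReal_eq_integral_smul one_ne_zero]
  have key := integral_mul_deriv_eq_deriv_mul_of_integrable (u := φ) (u' := φ')
    (v := gaussianPDFReal 0 1) (v' := fun x => -(x * gaussianPDFReal 0 1 x))
    (fun x _ => hd x) (fun x _ => hasDerivAt_gaussianPDFReal_std x)
    (h2.neg.congr (ae_of_all _ fun x => by simp; ring))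
    (h3.congr (ae_of_all _ fun x => by simp; ring))
    (h1.congr (ae_of_all _ fun x => by simp; ring))
  simp only [smul_eq_mul]
  have e1 : ∫ x, gaussianPDFReal 0 1 x * (x * φ x) =
      -∫ x, φ x * -(x * gaussianPDFReal 0 1 x) := by
    rw [← integral_neg]; congr 1; ext x; ring
  rw [e1, key, neg_neg]
  congr 1; ext x; ring

section Stein

variable {Ω : Type*} [MeasurableSpace Ω] {P : Measure Ω} {κ : Type*} [Fintype κ]

/-- Since `Var[X] = 1`, the regression residual of `Y` on `X` is uncorrelated with `X`; joint
Gaussianity turns this into independence. -/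
theorem indepFun_sub_covariance_mul {X : Ω → ℝ} {Y : κ → Ω → ℝ}
    (hXY : HasGaussianLaw (fun ω => (X ω, fun j => Y j ω)) P) (hv : Var[X; P] = 1) :
    IndepFun X (fun ω j => Y j ω - cov[X, Y j; P] * X ω) P := by
  have := hXY.isProbabilityMeasure
  let L : ℝ × (κ → ℝ) →L[ℝ] (Unit → ℝ) × (κ → ℝ) :=
    (ContinuousLinearMap.pi fun _ => ContinuousLinearMap.fst ℝ ℝ (κ → ℝ)).prod
      (ContinuousLinearMap.pi fun j =>
        (ContinuousLinearMap.proj j).comp (ContinuousLinearMap.snd ℝ ℝ (κ → ℝ)) -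
          cov[X, Y j; P] • ContinuousLinearMap.fst ℝ ℝ (κ → ℝ))
  have hX2 : MemLp X 2 P := hXY.fst.memLp_two
  have hY2 : ∀ j, MemLp (Y j) 2 P := fun j => (hXY.snd.eval j).memLp_two
  have h := HasGaussianLaw.indepFun_of_covariance_eval (ι := Unit) (κ := κ) (P := P)
    (X := fun _ => X) (Y := fun j ω => Y j ω - cov[X, Y j; P] * X ω) (hXY.map L) (by
      intro _ j
      rw [covariance_fun_sub_right hX2 (hY2 j) (hX2.const_mul _), covariance_const_mul_right,
        covariance_self hXY.fst.aemeasurable, hv, mul_one, sub_self])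
  exact h.comp (φ := fun x : Unit → ℝ => x ()) (ψ := id) (measurable_pi_apply _) measurable_id

/-- **Stein's identity** for a Gaussian vector `(X, Y)` with `X` standard: `D` is the derivative
of `F` in the direction `(1, cov(X, Y))`. -/
theorem stein_identity {X : Ω → ℝ} {Y : κ → Ω → ℝ}
    (hXY : HasGaussianLaw (fun ω => (X ω, fun j => Y j ω)) P) (h0 : ∫ ω, X ω ∂P = 0)
    (hv : Var[X; P] = 1) {F D : ℝ → (κ → ℝ) → ℝ}
    (hF : Measurable (Function.uncurry F)) (hD : Measurable (Function.uncurry D))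
    (hder : ∀ x (w : κ → ℝ), HasDerivAt (fun z => F z (fun j => w j + cov[X, Y j; P] * z))
      (D x (fun j => w j + cov[X, Y j; P] * x)) x)
    (h1 : Integrable (fun ω => F (X ω) (fun j => Y j ω)) P)
    (h2 : Integrable (fun ω => X ω * F (X ω) (fun j => Y j ω)) P)
    (h3 : Integrable (fun ω => D (X ω) (fun j => Y j ω)) P) :
    ∫ ω, X ω * F (X ω) (fun j => Y j ω) ∂P = ∫ ω, D (X ω) (fun j => Y j ω) ∂P := by
  have := hXY.isProbabilityMeasure
  set W : Ω → κ → ℝ := fun ω j => Y j ω - cov[X, Y j; P] * X ω with hW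
  have hXm : AEMeasurable X P := hXY.fst.aemeasurable
  have hYm : ∀ j, AEMeasurable (Y j) P := fun j => (hXY.snd.eval j).aemeasurable
  have hWm : AEMeasurable W P :=
    aemeasurable_pi_lambda _ fun j => (hYm j).sub (hXm.const_mul _)
  have hind : IndepFun X W P := indepFun_sub_covariance_mul hXY hv
  -- With the residual `W` frozen, `Y` is affine in `X` with slope the covariance. Fubini therefore
  -- reduces the claim to the one-dimensional formula on each line.
  have hmap : P.map (fun ω => (X ω, W ω)) = (gaussianReal 0 1).prod (P.map W) := by
    rw [(indepFun_iff_map_prod_eq_prod_map_map hXm hWm).1 hind, hXY.fst.map_eq_gaussianReal, h0, hv]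
    simp
  have hWp : IsProbabilityMeasure (P.map W) := Measure.isProbabilityMeasure_map hWm
  have hYW : ∀ ω, (fun j => Y j ω) = fun j => W ω j + cov[X, Y j; P] * X ω := by
    intro ω; ext j; simp [hW]
  have hpair : AEMeasurable (fun ω => (X ω, W ω)) P := hXm.prodMk hWm
  have htr : Measurable (fun u : ℝ × (κ → ℝ) => (u.1, fun j => u.2 j + cov[X, Y j; P] * u.1)) := by
    fun_prop
  have mF : Measurable (fun u : ℝ × (κ → ℝ) => F u.1 (fun j => u.2 j + cov[X, Y j; P] * u.1)) :=
    hF.comp htr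
  have mD : Measurable (fun u : ℝ × (κ → ℝ) => D u.1 (fun j => u.2 j + cov[X, Y j; P] * u.1)) :=
    hD.comp htr
  have mXF : Measurable
      (fun u : ℝ × (κ → ℝ) => u.1 * F u.1 (fun j => u.2 j + cov[X, Y j; P] * u.1)) :=
    measurable_fst.mul mF
  simp_rw [hYW] at h1 h2 h3 ⊢
  have i1 : Integrable (fun u : ℝ × (κ → ℝ) => F u.1 (fun j => u.2 j + cov[X, Y j; P] * u.1))
      ((gaussianReal 0 1).prod (P.map W)) := by
    rw [← hmap]; exact (integrable_map_measure mF.aestronglyMeasurable hpair).2 h1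
  have i2 : Integrable
      (fun u : ℝ × (κ → ℝ) => u.1 * F u.1 (fun j => u.2 j + cov[X, Y j; P] * u.1))
      ((gaussianReal 0 1).prod (P.map W)) := by
    rw [← hmap]; exact (integrable_map_measure mXF.aestronglyMeasurable hpair).2 h2
  have i3 : Integrable (fun u : ℝ × (κ → ℝ) => D u.1 (fun j => u.2 j + cov[X, Y j; P] * u.1))
      ((gaussianReal 0 1).prod (P.map W)) := by
    rw [← hmap]; exact (integrable_map_measure mD.aestronglyMeasurable hpair).2 h3
  have e2 := integral_map hpair (mXF.aestronglyMeasurable (μ := P.map (fun ω => (X ω, W ω))))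
  have e3 := integral_map hpair (mD.aestronglyMeasurable (μ := P.map (fun ω => (X ω, W ω))))
  simp only at e2 e3
  rw [← e2, ← e3, hmap, integral_prod_symm _ i2, integral_prod_symm _ i3]
  apply integral_congr_ae
  filter_upwards [i1.prod_left_ae, i2.prod_left_ae, i3.prod_left_ae] with w w1 w2 w3
  exact gaussian_integral_by_parts (fun x => hder x w) w1 w2 w3

end Stein

/-! ### Mixed moments with odd powers. -/

/-- Smooth functions all of whose derivatives are `O(exp (ε x ^ 2))` for every `ε > 0`. -/
structure SmoothSubGaussian (f : ℝ → ℝ) : Prop where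
  contDiff : ContDiff ℝ (⊤ : ℕ∞) f
  bound : ∀ (k : ℕ) (ε : ℝ), 0 < ε → ∃ C, ∀ x, |iteratedDeriv k f x| ≤ C * Real.exp (ε * x ^ 2)

namespace SmoothSubGaussian

variable {f : ℝ → ℝ}

theorem deriv (hf : SmoothSubGaussian f) : SmoothSubGaussian (deriv f) where
  contDiff := (contDiff_infty_iff_deriv.1 hf.contDiff).2
  bound k := by simpa only [iteratedDeriv_succ'] using hf.bound (k + 1)

theorem iteratedDeriv (hf : SmoothSubGaussian f) (k : ℕ) :
    SmoothSubGaussian (iteratedDeriv k f) := by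
  induction k with
  | zero => simpa using hf
  | succ k ih => rw [iteratedDeriv_succ]; exact ih.deriv

theorem differentiable (hf : SmoothSubGaussian f) : Differentiable ℝ f :=
  hf.contDiff.differentiable (by simp)

theorem measurable (hf : SmoothSubGaussian f) : Measurable f := hf.contDiff.continuous.measurable

theorem exists_bound (hf : SmoothSubGaussian f) {V : ℝ} (hV : 0 < V) :
    ∃ C, ∀ x, |f x| ≤ C * Real.exp (x ^ 2 / (16 * V)) := by
  obtain ⟨C, hC⟩ := hf.bound 0 (1 / (16 * V)) (by positivity)
  refine ⟨C, fun x => (hC x).trans_eq ?_⟩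
  rw [one_div_mul_eq_div]

end SmoothSubGaussian

section OddMoments

variable {Ω : Type*} [MeasurableSpace Ω] {P : Measure Ω}

/-- A centered Gaussian vector `(Z₁, Z₂, Y₁, Y₂)` with `Z₁`, `Z₂` standard and `Y₁`, `Y₂` of
variance at most `V`. -/
structure IsGaussianQuad (P : Measure Ω) (V : ℝ) (Z₁ Z₂ Y₁ Y₂ : Ω → ℝ) : Prop where
  law : HasGaussianLaw (fun ω => (Z₁ ω, Z₂ ω, Y₁ ω, Y₂ ω)) P
  mean_Z₁ : ∫ ω, Z₁ ω ∂P = 0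
  mean_Z₂ : ∫ ω, Z₂ ω ∂P = 0
  mean_Y₁ : ∫ ω, Y₁ ω ∂P = 0
  mean_Y₂ : ∫ ω, Y₂ ω ∂P = 0
  var_Z₁ : Var[Z₁; P] = 1
  var_Z₂ : Var[Z₂; P] = 1
  var_Y₁ : Var[Y₁; P] ≤ V
  var_Y₂ : Var[Y₂; P] ≤ V

/-- The mixed moment `E[Z₁ ^ p * Z₂ ^ q * f Y₁ * h Y₂]`. -/
noncomputable def mixedMoment (P : Measure Ω) (Z₁ Z₂ Y₁ Y₂ : Ω → ℝ) (p q : ℕ) (f h : ℝ → ℝ) : ℝ :=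
  ∫ ω, Z₁ ω ^ p * Z₂ ω ^ q * (f (Y₁ ω) * h (Y₂ ω)) ∂P

theorem mixedMoment_swap (Z₁ Z₂ Y₁ Y₂ : Ω → ℝ) (p q : ℕ) (f h : ℝ → ℝ) :
    mixedMoment P Z₁ Z₂ Y₁ Y₂ p q f h = mixedMoment P Z₂ Z₁ Y₁ Y₂ q p f h := by
  unfold mixedMoment
  congr 1; ext ω; ring

namespace IsGaussianQuad

variable {V : ℝ} {Z₁ Z₂ Y₁ Y₂ : Ω → ℝ}

theorem swap (hq : IsGaussianQuad P V Z₁ Z₂ Y₁ Y₂) : IsGaussianQuad P V Z₂ Z₁ Y₁ Y₂ where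
  law := by
    let a := ContinuousLinearMap.fst ℝ ℝ (ℝ × ℝ × ℝ)
    let s := ContinuousLinearMap.snd ℝ ℝ (ℝ × ℝ × ℝ)
    exact hq.law.map ((((ContinuousLinearMap.fst ℝ ℝ (ℝ × ℝ)).comp s)).prod
      (a.prod ((ContinuousLinearMap.snd ℝ ℝ (ℝ × ℝ)).comp s)))
  mean_Z₁ := hq.mean_Z₂
  mean_Z₂ := hq.mean_Z₁
  mean_Y₁ := hq.mean_Y₁
  mean_Y₂ := hq.mean_Y₂
  var_Z₁ := hq.var_Z₂
  var_Z₂ := hq.var_Z₁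
  var_Y₁ := hq.var_Y₁
  var_Y₂ := hq.var_Y₂

theorem law_pi (hq : IsGaussianQuad P V Z₁ Z₂ Y₁ Y₂) :
    HasGaussianLaw (fun ω => (Z₁ ω, fun j : Fin 3 => ![Z₂, Y₁, Y₂] j ω)) P := by
  let a := ContinuousLinearMap.fst ℝ ℝ (ℝ × ℝ × ℝ)
  let s := ContinuousLinearMap.snd ℝ ℝ (ℝ × ℝ × ℝ)
  let s' := (ContinuousLinearMap.snd ℝ ℝ (ℝ × ℝ)).comp s
  have h := hq.law.map (a.prod (ContinuousLinearMap.pi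
    ![(ContinuousLinearMap.fst ℝ ℝ (ℝ × ℝ)).comp s, (ContinuousLinearMap.fst ℝ ℝ ℝ).comp s',
      (ContinuousLinearMap.snd ℝ ℝ ℝ).comp s']))
  refine h.congr (ae_of_all _ fun ω => Prod.ext rfl ?_)
  funext j
  fin_cases j <;> rfl

end IsGaussianQuad

theorem exists_quad_moment_bound (P : Measure Ω) (p q : ℕ) {V : ℝ} (hV : 0 < V) {f h : ℝ → ℝ}
    (hf : SmoothSubGaussian f) (hh : SmoothSubGaussian h) :
    ∃ C, 0 ≤ C ∧ ∀ Z₁ Z₂ Y₁ Y₂ : Ω → ℝ, IsGaussianQuad P V Z₁ Z₂ Y₁ Y₂ →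
      Integrable (fun ω => Z₁ ω ^ p * Z₂ ω ^ q * (f (Y₁ ω) * h (Y₂ ω))) P ∧
      |mixedMoment P Z₁ Z₂ Y₁ Y₂ p q f h| ≤ C := by
  obtain ⟨C, hC, H⟩ := exists_moment_bound P p q hV hf.measurable hh.measurable
    (hf.exists_bound hV) (hh.exists_bound hV)
  refine ⟨C, hC, fun Z₁ Z₂ Y₁ Y₂ hq => ?_⟩
  obtain ⟨h1, h2⟩ := H Z₁ Z₂ Y₁ Y₂ hq.law.fst hq.law.snd.fst hq.law.snd.snd.fst hq.law.snd.snd.snd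
    hq.mean_Z₁ hq.mean_Z₂ hq.mean_Y₁ hq.mean_Y₂ hq.var_Z₁.le hq.var_Z₂.le hq.var_Y₁ hq.var_Y₂
  exact ⟨h1, (abs_integral_le_integral_abs).trans h2⟩

theorem IsGaussianQuad.integrable {V : ℝ} {Z₁ Z₂ Y₁ Y₂ : Ω → ℝ} (hV : 0 < V)
    (hq : IsGaussianQuad P V Z₁ Z₂ Y₁ Y₂) {f h : ℝ → ℝ}
    (hf : SmoothSubGaussian f) (hh : SmoothSubGaussian h) (p q : ℕ) :
    Integrable (fun ω => Z₁ ω ^ p * Z₂ ω ^ q * (f (Y₁ ω) * h (Y₂ ω))) P := by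
  obtain ⟨C, _, H⟩ := exists_quad_moment_bound P p q hV hf hh
  exact (H _ _ _ _ hq).1

/-- Stein's identity after splitting off one factor `Z₁`; the four terms come from the product rule.
The truncated exponents `p - 1` and `q - 1` are harmless, since at zero their coefficients vanish.
-/
theorem mixedMoment_succ {V : ℝ} {Z₁ Z₂ Y₁ Y₂ : Ω → ℝ} (hV : 0 < V)
    (hq : IsGaussianQuad P V Z₁ Z₂ Y₁ Y₂) {f h : ℝ → ℝ}
    (hf : SmoothSubGaussian f) (hh : SmoothSubGaussian h) (p q : ℕ) :
    mixedMoment P Z₁ Z₂ Y₁ Y₂ (p + 1) q f h =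
      p * mixedMoment P Z₁ Z₂ Y₁ Y₂ (p - 1) q f h
      + q * cov[Z₁, Z₂; P] * mixedMoment P Z₁ Z₂ Y₁ Y₂ p (q - 1) f h
      + cov[Z₁, Y₁; P] * mixedMoment P Z₁ Z₂ Y₁ Y₂ p q (deriv f) h
      + cov[Z₁, Y₂; P] * mixedMoment P Z₁ Z₂ Y₁ Y₂ p q f (deriv h) := by
  set c := cov[Z₁, Z₂; P] with hc
  set a := cov[Z₁, Y₁; P] with ha
  set b := cov[Z₁, Y₂; P] with hb
  have i1 := hq.integrable hV hf hh (p - 1) q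
  have i2 := hq.integrable hV hf hh p (q - 1)
  have i3 := hq.integrable hV hf.deriv hh p q
  have i4 := hq.integrable hV hf hh.deriv p q
  have j1 := i1.const_mul (p : ℝ)
  have j2 := i2.const_mul (q * c)
  have j3 := i3.const_mul a
  have j4 := i4.const_mul b
  have hs := stein_identity (P := P) (X := Z₁) (Y := ![Z₂, Y₁, Y₂]) hq.law_pi hq.mean_Z₁ hq.var_Z₁
    (F := fun x v => x ^ p * v 0 ^ q * (f (v 1) * h (v 2)))
    (D := fun x v => p * (x ^ (p - 1) * v 0 ^ q * (f (v 1) * h (v 2)))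
      + q * c * (x ^ p * v 0 ^ (q - 1) * (f (v 1) * h (v 2)))
      + a * (x ^ p * v 0 ^ q * (deriv f (v 1) * h (v 2)))
      + b * (x ^ p * v 0 ^ q * (f (v 1) * deriv h (v 2))))
    (by
      have := hf.measurable; have := hh.measurable
      unfold Function.uncurry; fun_prop)
    (by
      have := hf.measurable; have := hh.measurable
      have := hf.deriv.measurable; have := hh.deriv.measurable
      unfold Function.uncurry; fun_prop)
    (by
      intro x w
      have e0 : HasDerivAt (fun z : ℝ => w 0 + c * z) c x := by
        simpa using ((hasDerivAt_id x).const_mul c).const_add (w 0)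
      have e1 : HasDerivAt (fun z : ℝ => w 1 + a * z) a x := by
        simpa using ((hasDerivAt_id x).const_mul a).const_add (w 1)
      have e2 : HasDerivAt (fun z : ℝ => w 2 + b * z) b x := by
        simpa using ((hasDerivAt_id x).const_mul b).const_add (w 2)
      have d1 := (hf.differentiable (w 1 + a * x)).hasDerivAt.comp x e1
      have d2 := (hh.differentiable (w 2 + b * x)).hasDerivAt.comp x e2
      have := ((hasDerivAt_pow p x).mul (e0.pow q)).mul (d1.mul d2)
      convert! this using 1
      simp only [Function.comp_apply, Pi.mul_apply, Pi.pow_apply, Matrix.cons_val, ← hc, ← ha, ← hb]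
      ring)
    (hq.integrable hV hf hh p q)
    ((hq.integrable hV hf hh (p + 1) q).congr (ae_of_all _ fun ω => by
      simp only [Matrix.cons_val]; ring))
    (((j1.add j2).add j3).add j4)
  simp only [Matrix.cons_val] at hs
  unfold mixedMoment
  have e : ∀ ω, Z₁ ω ^ (p + 1) * Z₂ ω ^ q * (f (Y₁ ω) * h (Y₂ ω)) =
      Z₁ ω * (Z₁ ω ^ p * Z₂ ω ^ q * (f (Y₁ ω) * h (Y₂ ω))) := fun ω => by ring
  simp_rw [e]
  have hadd := integral_add' ((j1.add j2).add j3) j4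
  rw [integral_add' (j1.add j2) j3, integral_add' j1 j2] at hadd
  simp only [integral_const_mul] at hadd
  exact hs.trans hadd

/-- Splitting off one `Z₂` yields three terms carrying a covariance of `Z₂`, and one term whose
`Z₂`-exponent is lower by two, hence again odd. The induction ends at exponent one, where that last
term has coefficient zero. The constant is chosen before the Gaussian vector, so it serves all pairs
of grid steps at once. -/
theorem exists_bound_of_odd (P : Measure Ω) {V : ℝ} (hV : 0 < V) (b : ℕ) :
    ∀ (p : ℕ) {f h : ℝ → ℝ}, SmoothSubGaussian f → SmoothSubGaussian h →
    ∃ C, 0 ≤ C ∧ ∀ Z₁ Z₂ Y₁ Y₂ : Ω → ℝ, IsGaussianQuad P V Z₁ Z₂ Y₁ Y₂ →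
      |mixedMoment P Z₁ Z₂ Y₁ Y₂ p (2 * b + 1) f h| ≤
        C * (|cov[Z₁, Z₂; P]| + (|cov[Z₂, Y₁; P]| + |cov[Z₂, Y₂; P]|)) := by
  intro p f h hf hh
  have hrest : ∃ C₂ C₃ C₄ : ℝ, 0 ≤ C₂ ∧ 0 ≤ C₃ ∧ 0 ≤ C₄ ∧ ∀ Z₁ Z₂ Y₁ Y₂ : Ω → ℝ,
      IsGaussianQuad P V Z₁ Z₂ Y₁ Y₂ →
      |mixedMoment P Z₂ Z₁ Y₁ Y₂ (2 * b) (p - 1) f h| ≤ C₂ ∧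
      |mixedMoment P Z₂ Z₁ Y₁ Y₂ (2 * b) p (deriv f) h| ≤ C₃ ∧
      |mixedMoment P Z₂ Z₁ Y₁ Y₂ (2 * b) p f (deriv h)| ≤ C₄ := by
    obtain ⟨C₂, h2, H2⟩ := exists_quad_moment_bound P (2 * b) (p - 1) hV hf hh
    obtain ⟨C₃, h3, H3⟩ := exists_quad_moment_bound P (2 * b) p hV hf.deriv hh
    obtain ⟨C₄, h4, H4⟩ := exists_quad_moment_bound P (2 * b) p hV hf hh.deriv
    exact ⟨C₂, C₃, C₄, h2, h3, h4, fun Z₁ Z₂ Y₁ Y₂ hq =>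
      ⟨(H2 _ _ _ _ hq.swap).2, (H3 _ _ _ _ hq.swap).2, (H4 _ _ _ _ hq.swap).2⟩⟩
  obtain ⟨C₂, C₃, C₄, h2, h3, h4, H⟩ := hrest
  have hprev : ∃ C₁ : ℝ, 0 ≤ C₁ ∧ ∀ Z₁ Z₂ Y₁ Y₂ : Ω → ℝ, IsGaussianQuad P V Z₁ Z₂ Y₁ Y₂ →
      |((2 * b : ℕ) : ℝ) * mixedMoment P Z₂ Z₁ Y₁ Y₂ (2 * b - 1) p f h| ≤
        C₁ * (|cov[Z₁, Z₂; P]| + (|cov[Z₂, Y₁; P]| + |cov[Z₂, Y₂; P]|)) := by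
    cases b with
    | zero => exact ⟨0, le_rfl, fun Z₁ Z₂ Y₁ Y₂ _ => by simp⟩
    | succ b =>
      obtain ⟨C, hC, HC⟩ := exists_bound_of_odd P hV b p hf hh
      refine ⟨(2 * (b + 1) : ℕ) * C, by positivity, fun Z₁ Z₂ Y₁ Y₂ hq => ?_⟩
      rw [abs_mul, Nat.abs_cast, mul_assoc, show 2 * (b + 1) - 1 = 2 * b + 1 by omega,
        mixedMoment_swap]
      gcongr
      exact HC _ _ _ _ hq
  obtain ⟨C₁, h1, H1⟩ := hprev
  refine ⟨C₁ + p * C₂ + C₃ + C₄, by positivity, fun Z₁ Z₂ Y₁ Y₂ hq => ?_⟩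
  obtain ⟨k2, k3, k4⟩ := H _ _ _ _ hq
  have k1 := H1 _ _ _ _ hq
  rw [mixedMoment_swap, mixedMoment_succ hV hq.swap hf hh, covariance_comm Z₂ Z₁]
  set c := cov[Z₁, Z₂; P]
  set x := cov[Z₂, Y₁; P]
  set y := cov[Z₂, Y₂; P]
  have t2 : |p * c * mixedMoment P Z₂ Z₁ Y₁ Y₂ (2 * b) (p - 1) f h| ≤ p * |c| * C₂ := by
    rw [abs_mul, abs_mul, Nat.abs_cast]; gcongr
  have t3 : |x * mixedMoment P Z₂ Z₁ Y₁ Y₂ (2 * b) p (deriv f) h| ≤ |x| * C₃ := by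
    rw [abs_mul]; gcongr
  have t4 : |y * mixedMoment P Z₂ Z₁ Y₁ Y₂ (2 * b) p f (deriv h)| ≤ |y| * C₄ := by
    rw [abs_mul]; gcongr
  refine (abs_add_le _ _).trans ((add_le_add ((abs_add_le _ _).trans
    (add_le_add ((abs_add_le _ _).trans (add_le_add k1 t2)) t3)) t4).trans ?_)
  have g2 : 0 ≤ p * C₂ * (|x| + |y|) := by positivity
  have g3 : 0 ≤ C₃ * (|c| + |y|) := by positivity
  have g4 : 0 ≤ C₄ * (|c| + |x|) := by positivity
  linarith

/-- Splitting off one `Z₁` either lowers its exponent by two, or produces `cov[Z₁, Z₂]`, or produces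
a covariance of `Z₁` with some `Yᵢ`. In the last case `Z₂` still has an odd exponent, and
`exists_bound_of_odd` supplies a second small factor. -/
theorem exists_bound_of_odd_of_odd (P : Measure Ω) {V : ℝ} (hV : 0 < V) (a : ℕ) :
    ∀ (b : ℕ) {f h : ℝ → ℝ}, SmoothSubGaussian f → SmoothSubGaussian h →
    ∃ C, 0 ≤ C ∧ ∀ Z₁ Z₂ Y₁ Y₂ : Ω → ℝ, IsGaussianQuad P V Z₁ Z₂ Y₁ Y₂ →
      |cov[Z₁, Y₁; P]| ≤ 1 → |cov[Z₁, Y₂; P]| ≤ 1 →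
      |mixedMoment P Z₁ Z₂ Y₁ Y₂ (2 * a + 1) (2 * b + 1) f h| ≤
        C * (|cov[Z₁, Z₂; P]| + (|cov[Z₁, Y₁; P]| + |cov[Z₁, Y₂; P]|) *
          (|cov[Z₂, Y₁; P]| + |cov[Z₂, Y₂; P]|)) := by
  intro b f h hf hh
  obtain ⟨C₂, h2, H2⟩ := exists_quad_moment_bound P (2 * a) (2 * b) hV hf hh
  obtain ⟨C₃, h3, H3⟩ := exists_bound_of_odd P hV b (2 * a) hf.deriv hh
  obtain ⟨C₄, h4, H4⟩ := exists_bound_of_odd P hV b (2 * a) hf hh.deriv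
  have hprev : ∃ C₁ : ℝ, 0 ≤ C₁ ∧ ∀ Z₁ Z₂ Y₁ Y₂ : Ω → ℝ, IsGaussianQuad P V Z₁ Z₂ Y₁ Y₂ →
      |cov[Z₁, Y₁; P]| ≤ 1 → |cov[Z₁, Y₂; P]| ≤ 1 →
      |((2 * a : ℕ) : ℝ) * mixedMoment P Z₁ Z₂ Y₁ Y₂ (2 * a - 1) (2 * b + 1) f h| ≤
        C₁ * (|cov[Z₁, Z₂; P]| + (|cov[Z₁, Y₁; P]| + |cov[Z₁, Y₂; P]|) *
          (|cov[Z₂, Y₁; P]| + |cov[Z₂, Y₂; P]|)) := by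
    cases a with
    | zero => exact ⟨0, le_rfl, fun Z₁ Z₂ Y₁ Y₂ _ _ _ => by simp⟩
    | succ a =>
      obtain ⟨C, hC, HC⟩ := exists_bound_of_odd_of_odd P hV a b hf hh
      refine ⟨(2 * (a + 1) : ℕ) * C, by positivity, fun Z₁ Z₂ Y₁ Y₂ hq u1 u2 => ?_⟩
      rw [abs_mul, Nat.abs_cast, mul_assoc, show 2 * (a + 1) - 1 = 2 * a + 1 by omega]
      gcongr
      exact HC _ _ _ _ hq u1 u2
  obtain ⟨C₁, h1, H1⟩ := hprev
  refine ⟨C₁ + (2 * b + 1 : ℕ) * C₂ + C₃ + C₄, by positivity, fun Z₁ Z₂ Y₁ Y₂ hq u1 u2 => ?_⟩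
  have k1 := H1 _ _ _ _ hq u1 u2
  have k2 := (H2 _ _ _ _ hq).2
  have k3 := H3 _ _ _ _ hq
  have k4 := H4 _ _ _ _ hq
  rw [mixedMoment_succ hV hq hf hh, Nat.add_sub_cancel]
  set c := cov[Z₁, Z₂; P]
  set u := cov[Z₁, Y₁; P]
  set v := cov[Z₁, Y₂; P]
  set s := |cov[Z₂, Y₁; P]| + |cov[Z₂, Y₂; P]|
  have hs : 0 ≤ s := by positivity
  have t2 : |((2 * b + 1 : ℕ) : ℝ) * c * mixedMoment P Z₁ Z₂ Y₁ Y₂ (2 * a) (2 * b) f h| ≤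
      ((2 * b + 1 : ℕ) : ℝ) * |c| * C₂ := by
    rw [abs_mul, abs_mul, Nat.abs_cast]; gcongr
  have t3 : |u * mixedMoment P Z₁ Z₂ Y₁ Y₂ (2 * a) (2 * b + 1) (deriv f) h| ≤
      |u| * (C₃ * (|c| + s)) := by
    rw [abs_mul]; gcongr
  have t4 : |v * mixedMoment P Z₁ Z₂ Y₁ Y₂ (2 * a) (2 * b + 1) f (deriv h)| ≤
      |v| * (C₄ * (|c| + s)) := by
    rw [abs_mul]; gcongr
  refine (abs_add_le _ _).trans ((add_le_add ((abs_add_le _ _).trans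
    (add_le_add ((abs_add_le _ _).trans (add_le_add k1 t2)) t3)) t4).trans ?_)
  have g2 : 0 ≤ ((2 * b + 1 : ℕ) : ℝ) * C₂ * ((|u| + |v|) * s) := by positivity
  have g3 : 0 ≤ C₃ * (|v| * s) := by positivity
  have g4 : 0 ≤ C₄ * (|u| * s) := by positivity
  -- The cross terms containing `cov[Z₁, Z₂]` are absorbed into its linear term; this is what the
  -- bound 1 on the covariances of `Z₁` with the `Yᵢ` is for.
  have g5 : |u| * (C₃ * |c|) ≤ C₃ * |c| := mul_le_of_le_one_left (by positivity) u1
  have g6 : |v| * (C₄ * |c|) ≤ C₄ * |c| := mul_le_of_le_one_left (by positivity) u2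
  linarith

end OddMoments

/-! ### Taylor expansion and the local error of Simpson's rule. -/

/-- The derivative of the remainder of order `n + 1` is the remainder of order `n` of `deriv f`, so
the mean value inequality gains one factor `|s|` per step. The factor `1 / n!` is given up. -/
theorem abs_sub_taylor_le (n : ℕ) {f : ℝ → ℝ} (hf : ContDiff ℝ (⊤ : ℕ∞) f) {m r K : ℝ}
    (hK : ∀ x, |x - m| ≤ r → |iteratedDeriv n f x| ≤ K) {s : ℝ} (hs : |s| ≤ r) :
    |f (m + s) - ∑ k ∈ Finset.range n, iteratedDeriv k f m * s ^ k / k.factorial| ≤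
      K * |s| ^ n := by
  induction n generalizing f s with
  | zero => simpa using hK (m + s) (by simpa using hs)
  | succ n ih =>
    have hf' : ContDiff ℝ (⊤ : ℕ∞) (deriv f) := (contDiff_infty_iff_deriv.1 hf).2
    have hfd : Differentiable ℝ f := hf.differentiable (by simp)
    have hK0 : 0 ≤ K := (abs_nonneg _).trans (hK m (by simpa using (abs_nonneg s).trans hs))
    have hd : ∀ z : ℝ, HasDerivAt
        (fun z => f (m + z) - ∑ k ∈ Finset.range (n + 1), iteratedDeriv k f m * z ^ k / k.factorial)
        (deriv f (m + z) -
          ∑ k ∈ Finset.range n, iteratedDeriv k (deriv f) m * z ^ k / k.factorial) z := by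
      intro z
      have h1 : HasDerivAt (fun z => f (m + z)) (deriv f (m + z)) z := by
        simpa using (hfd (m + z)).hasDerivAt.comp_const_add m z
      have h2 : HasDerivAt
          (fun z => ∑ k ∈ Finset.range (n + 1), iteratedDeriv k f m * z ^ k / k.factorial)
          (∑ k ∈ Finset.range (n + 1), iteratedDeriv k f m * (k * z ^ (k - 1)) / k.factorial) z :=
        HasDerivAt.fun_sum fun k _ => ((hasDerivAt_pow k z).const_mul _).div_const _
      convert! h1.sub h2 using 1
      rw [Finset.sum_range_succ']
      simp only [Nat.cast_zero, zero_mul, mul_zero, zero_div, add_zero, Nat.add_sub_cancel]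
      congr 1
      refine Finset.sum_congr rfl fun k _ => ?_
      rw [← iteratedDeriv_succ', Nat.factorial_succ]
      push_cast
      field_simp
    have hb : ∀ z ∈ Metric.closedBall (0 : ℝ) |s|, ‖deriv f (m + z) -
        ∑ k ∈ Finset.range n, iteratedDeriv k (deriv f) m * z ^ k / k.factorial‖ ≤
        K * |s| ^ n := by
      intro z hz
      rw [mem_closedBall_zero_iff, Real.norm_eq_abs] at hz
      refine (ih hf' (fun x hx => ?_) (hz.trans hs)).trans ?_
      · rw [← iteratedDeriv_succ']; exact hK x hx
      · gcongr
    have := (convex_closedBall (0 : ℝ) |s|).norm_image_sub_le_of_norm_hasDerivWithin_le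
      (fun z _ => (hd z).hasDerivWithinAt) hb (x := 0) (y := s) (by simp) (by simp)
    rw [Finset.sum_range_succ' (fun k => iteratedDeriv k f m * (0 : ℝ) ^ k / k.factorial)] at this
    simp only [add_zero, iteratedDeriv_zero, pow_zero, mul_one, Nat.factorial_zero, Nat.cast_one,
      div_one, sub_zero, Real.norm_eq_abs, ne_eq, Nat.add_eq_zero_iff, one_ne_zero, and_false,
      not_false_eq_true, zero_pow, mul_zero, zero_div, Finset.sum_const_zero, zero_add,
      sub_self] at this
    rwa [pow_succ, ← mul_assoc]

/-- The error of one step of Simpson's rule, expanded at the midpoint up to order ten. -/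
theorem abs_simpson_error_le {g : ℝ → ℝ} (hg : ContDiff ℝ (⊤ : ℕ∞) g) {a b K : ℝ}
    (hK : ∀ x ∈ Set.uIcc a b, |iteratedDeriv 10 g x| ≤ K) :
    |1 / 6 * (deriv g a + 4 * deriv g (1 / 2 * (a + b)) + deriv g b) * (b - a) - (g b - g a)
      - (1 / 2880 * (iteratedDeriv 5 g (1 / 2 * (a + b)) * (b - a) ^ 5)
        + 1 / 241920 * (iteratedDeriv 7 g (1 / 2 * (a + b)) * (b - a) ^ 7)
        + 1 / 46448640 * (iteratedDeriv 9 g (1 / 2 * (a + b)) * (b - a) ^ 9))| ≤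
      K * |b - a| ^ 10 := by
  obtain ⟨m, hm⟩ : ∃ m, m = 1 / 2 * (a + b) := ⟨_, rfl⟩
  obtain ⟨s, hs⟩ : ∃ s, s = 1 / 2 * (b - a) := ⟨_, rfl⟩
  have hb : b = m + s := by rw [hm, hs]; ring
  have ha : a = m + -s := by rw [hm, hs]; ring
  have hball : ∀ x, |x - m| ≤ |s| → x ∈ Set.uIcc a b := by
    intro x hx
    rw [Set.mem_uIcc]
    rcases le_total 0 s with h | h
    · rw [abs_of_nonneg h, abs_le] at hx
      left; constructor <;> linarith [hx.1, hx.2]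
    · rw [abs_of_nonpos h, abs_le] at hx
      right; constructor <;> linarith [hx.1, hx.2]
  have hg' : ContDiff ℝ (⊤ : ℕ∞) (deriv g) := (contDiff_infty_iff_deriv.1 hg).2
  have hK10 : ∀ x, |x - m| ≤ |s| → |iteratedDeriv 10 g x| ≤ K := fun x hx => hK x (hball x hx)
  have hK9 : ∀ x, |x - m| ≤ |s| → |iteratedDeriv 9 (deriv g) x| ≤ K := fun x hx => by
    rw [← iteratedDeriv_succ']; exact hK x (hball x hx)
  have hK0 : 0 ≤ K := (abs_nonneg _).trans (hK10 m (by simp))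
  have t1 := abs_sub_taylor_le 10 hg hK10 (s := s) le_rfl
  have t2 := abs_sub_taylor_le 10 hg hK10 (s := -s) (abs_neg s).le
  have t3 := abs_sub_taylor_le 9 hg' hK9 (s := s) le_rfl
  have t4 := abs_sub_taylor_le 9 hg' hK9 (s := -s) (abs_neg s).le
  rw [abs_neg] at t2 t4
  simp only [← iteratedDeriv_succ', Finset.sum_range_succ, Finset.sum_range_zero,
    Nat.factorial, iteratedDeriv_zero] at t1 t2 t3 t4
  have hd : b - a = 2 * s := by rw [hs]; ring
  have hd1 : deriv g m = iteratedDeriv 1 g m := by rw [iteratedDeriv_one]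
  rw [← hm, hd, hb, ha, hd1]
  rw [abs_mul 2 s, mul_pow, abs_two]
  -- Replacing each value by its Taylor polynomial plus a named error leaves a polynomial identity.
  -- With `s = (b - a) / 2`, the coefficient of the `k`-th derivative times `s ^ k`, for odd `k ≥
  -- 3`, is `2 (k - 3) / (3 k!)`: zero at `k = 3`, and the stated constants at 5, 7, 9 after
  -- division by `2 ^ k`.
  have split : ∀ {x y X : ℝ}, |x - y| ≤ X → ∃ E, x = E + y ∧ |E| ≤ X :=
    fun {x y _} h => ⟨x - y, by ring, h⟩
  obtain ⟨E1, h1, t1⟩ := split t1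
  obtain ⟨E2, h2, t2⟩ := split t2
  obtain ⟨E3, h3, t3⟩ := split t3
  obtain ⟨E4, h4, t4⟩ := split t4
  rw [h1, h2, h3, h4]
  have key : |1 / 6 * (E3 + E4) * (2 * s) - (E1 - E2)| ≤
      1 / 6 * (K * |s| ^ 9 + K * |s| ^ 9) * (2 * |s|) + (K * |s| ^ 10 + K * |s| ^ 10) := by
    refine (abs_sub _ _).trans (add_le_add ?_ ((abs_sub _ _).trans (add_le_add t1 t2)))
    rw [abs_mul, abs_mul, abs_mul, abs_two, abs_of_pos (by norm_num : (0 : ℝ) < 1 / 6)]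
    gcongr
    exact (abs_add_le _ _).trans (add_le_add t3 t4)
  refine (congrArg abs ?_).trans_le (key.trans ?_)
  · push_cast
    ring
  · have : 0 ≤ K * |s| ^ 10 := by positivity
    -- The errors total `(2/3 + 2) K |s| ^ 10`, far below the allowed `2 ^ 10 K |s| ^ 10`.
    nlinarith

/-! ### Growth bounds. -/

theorem exp_mul_sq_le_of_mem_uIcc {a b x ε : ℝ} (hε : 0 ≤ ε) (hx : x ∈ Set.uIcc a b) :
    Real.exp (ε * x ^ 2) ≤ Real.exp (ε * a ^ 2) + Real.exp (ε * b ^ 2) := by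
  have h : x ^ 2 ≤ a ^ 2 ∨ x ^ 2 ≤ b ^ 2 := by
    rw [sq_le_sq, sq_le_sq]
    rcases Set.mem_uIcc.1 hx with ⟨h1, h2⟩ | ⟨h1, h2⟩
    · rcases le_total 0 x with h | h
      · right; rw [abs_of_nonneg h]; exact h2.trans (le_abs_self b)
      · left; rw [abs_of_nonpos h]; exact (neg_le_neg h1).trans (neg_le_abs a)
    · rcases le_total 0 x with h | h
      · left; rw [abs_of_nonneg h]; exact h2.trans (le_abs_self a)
      · right; rw [abs_of_nonpos h]; exact (neg_le_neg h1).trans (neg_le_abs b)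
  rcases h with h | h
  · have : Real.exp (ε * x ^ 2) ≤ Real.exp (ε * a ^ 2) := by gcongr
    linarith [Real.exp_pos (ε * b ^ 2)]
  · have : Real.exp (ε * x ^ 2) ≤ Real.exp (ε * b ^ 2) := by gcongr
    linarith [Real.exp_pos (ε * a ^ 2)]

/-- As `α < 2`, the exponent `b |x| ^ α` is below `ε x ^ 2` for large `|x|`. Continuity handles the
remaining compact interval, where a negative `α` would make the growth bound useless near zero. -/
theorem ModerateGrowth.exists_bound {f : ℝ → ℝ} (hf : ModerateGrowth f) (hc : Continuous f)
    {ε : ℝ} (hε : 0 < ε) : ∃ C, ∀ x, |f x| ≤ C * Real.exp (ε * x ^ 2) := by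
  obtain ⟨A, b, α, hα, h⟩ := hf
  have hA : 0 ≤ A := by
    by_contra hA
    have h1 := (abs_nonneg _).trans (h 0)
    nlinarith [Real.exp_pos (b * |(0 : ℝ)| ^ α)]
  have hlim : Tendsto (fun y : ℝ => b * y ^ (-(2 - α))) atTop (nhds (b * 0)) :=
    (tendsto_rpow_neg_atTop (by linarith)).const_mul b
  rw [mul_zero] at hlim
  obtain ⟨R, hR⟩ := eventually_atTop.1 ((hlim.eventually_le_const hε).and (eventually_gt_atTop 0))
  obtain ⟨D, hD⟩ := (isCompact_Icc (a := -R) (b := R)).exists_bound_of_continuousOn hc.continuousOn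
  refine ⟨A + |D|, fun x => ?_⟩
  have hexp : 1 ≤ Real.exp (ε * x ^ 2) := Real.one_le_exp (by positivity)
  by_cases hx : |x| ≤ R
  · have h1 := hD x (abs_le.1 hx)
    rw [Real.norm_eq_abs] at h1
    have h2 : |D| * 1 ≤ |D| * Real.exp (ε * x ^ 2) := by gcongr
    nlinarith [le_abs_self D, mul_nonneg hA (Real.exp_pos (ε * x ^ 2)).le]
  · obtain ⟨h1, h2⟩ := hR |x| (not_le.1 hx).le
    have h3 : b * |x| ^ α ≤ ε * x ^ 2 := by
      have e : |x| ^ α = |x| ^ (-(2 - α)) * x ^ 2 := by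
        rw [← sq_abs, ← Real.rpow_two, ← Real.rpow_add h2]
        congr 1; ring
      rw [e, ← mul_assoc]
      gcongr
    calc |f x| ≤ A * Real.exp (b * |x| ^ α) := h x
      _ ≤ A * Real.exp (ε * x ^ 2) := by gcongr
      _ ≤ _ := by
        gcongr
        linarith [abs_nonneg D]

theorem smoothSubGaussian_of_moderateGrowth {g : ℝ → ℝ} (hg : ContDiff ℝ (⊤ : ℕ∞) g)
    (hgrowth : ∀ k : ℕ, ModerateGrowth (iteratedDeriv k g)) : SmoothSubGaussian g where
  contDiff := hg
  bound k _ hε := (hgrowth k).exists_bound (hg.continuous_iteratedDeriv k (by exact_mod_cast le_top)) hε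

theorem abs_sub_le_of_deriv_bound {g : ℝ → ℝ} (hg : Differentiable ℝ g) {a b K : ℝ}
    (hK : ∀ x ∈ Set.uIcc a b, |deriv g x| ≤ K) : |g b - g a| ≤ K * |b - a| :=
  (convex_uIcc a b).norm_image_sub_le_of_norm_deriv_le (fun x _ => hg x) hK
    Set.left_mem_uIcc Set.right_mem_uIcc

/-! ### Summability of correlations for concave weights. -/

/-- A nondecreasing concave sequence `w` with `w 0 = 0` and `w 1 = 1`. -/
structure IsConcaveWeight (w : ℕ → ℝ) : Prop where
  zero : w 0 = 0
  one : w 1 = 1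
  mono : Monotone w
  concave : ∀ m, w m + w (m + 2) ≤ 2 * w (m + 1)

/-- Increment in `j` of `w (dist j l)`. -/
def distIncr (w : ℕ → ℝ) (j l : ℕ) : ℝ := w (Nat.dist (j + 1) l) - w (Nat.dist j l)

/-- Correlation of the `j`-th and `k`-th normalized increments of a process with
`E|B_j - B_k|² = w (dist j k)`. -/
noncomputable def incrCorr (w : ℕ → ℝ) (j k : ℕ) : ℝ :=
  (w (Nat.dist (j + 1) k) + w (Nat.dist j (k + 1)) - 2 * w (Nat.dist j k)) / 2

/-- Covariance of the `j`-th increment with the midpoint of the `k`-th step. -/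
noncomputable def midCorr (w : ℕ → ℝ) (j k : ℕ) : ℝ :=
  (2 * (w (j + 1) - w j) - distIncr w j k - distIncr w j (k + 1)) / 4

namespace IsConcaveWeight

variable {w : ℕ → ℝ}

theorem nonneg (hw : IsConcaveWeight w) (m : ℕ) : 0 ≤ w m := hw.zero ▸ hw.mono (Nat.zero_le m)

theorem incr_nonneg (hw : IsConcaveWeight w) (m : ℕ) : 0 ≤ w (m + 1) - w m :=
  sub_nonneg.2 (hw.mono (Nat.le_succ m))

theorem incr_le_one (hw : IsConcaveWeight w) (m : ℕ) : w (m + 1) - w m ≤ 1 := by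
  induction m with
  | zero => simp [hw.zero, hw.one]
  | succ m ih => linarith [hw.concave m]

theorem distIncr_of_lt {j l : ℕ} (h : j < l) :
    distIncr w j l = -(w (l - j - 1 + 1) - w (l - j - 1)) := by
  rw [distIncr, Nat.dist_eq_sub_of_le h.le, Nat.dist_eq_sub_of_le (Nat.succ_le_of_lt h),
    show l - j - 1 + 1 = l - j by omega, show l - (j + 1) = l - j - 1 by omega]
  ring

theorem distIncr_of_ge {j l : ℕ} (h : l ≤ j) :
    distIncr w j l = w (j - l + 1) - w (j - l) := by
  rw [distIncr, Nat.dist_eq_sub_of_le_right h, Nat.dist_eq_sub_of_le_right (Nat.le_succ_of_le h),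
    show j + 1 - l = j - l + 1 by omega]

theorem abs_distIncr_le_one (hw : IsConcaveWeight w) (j l : ℕ) : |distIncr w j l| ≤ 1 := by
  rcases lt_or_ge j l with h | h
  · rw [distIncr_of_lt h, abs_neg, abs_of_nonneg (hw.incr_nonneg _)]
    exact hw.incr_le_one _
  · rw [distIncr_of_ge h, abs_of_nonneg (hw.incr_nonneg _)]
    exact hw.incr_le_one _

/-- By monotonicity the terms are nonpositive for `j < l` and nonnegative afterwards, so the
absolute values telescope on each side of `l`. -/
theorem sum_abs_distIncr (hw : IsConcaveWeight w) (l N : ℕ) :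
    ∑ j ∈ Finset.range N, |distIncr w j l| = if N ≤ l then w l - w (l - N) else w l + w (N - l) := by
  induction N with
  | zero => simp
  | succ N ih =>
    rw [Finset.sum_range_succ, ih]
    rcases lt_or_ge N l with h | h
    · rw [if_pos h.le, if_pos (Nat.succ_le_of_lt h), distIncr_of_lt h, abs_neg,
        abs_of_nonneg (hw.incr_nonneg _), show l - N - 1 + 1 = l - N by omega,
        show l - (N + 1) = l - N - 1 by omega]
      ring
    · rw [if_neg (by omega : ¬ N + 1 ≤ l), distIncr_of_ge h, abs_of_nonneg (hw.incr_nonneg _),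
        show N + 1 - l = N - l + 1 by omega]
      split_ifs with h'
      · obtain rfl : N = l := le_antisymm h' h
        simp [hw.zero]
      · ring

theorem sum_abs_distIncr_le (hw : IsConcaveWeight w) {l N : ℕ} (hl : l ≤ N) :
    ∑ j ∈ Finset.range N, |distIncr w j l| ≤ 2 * w N := by
  rw [hw.sum_abs_distIncr]
  have h1 := hw.mono hl
  split_ifs
  · linarith [hw.nonneg (l - N), hw.nonneg N]
  · linarith [hw.mono (Nat.sub_le N l)]

theorem sum_incr (hw : IsConcaveWeight w) (N : ℕ) :
    ∑ j ∈ Finset.range N, (w (j + 1) - w j) = w N := by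
  rw [Finset.sum_range_sub, hw.zero, sub_zero]

theorem abs_midCorr_le_one (hw : IsConcaveWeight w) (j k : ℕ) : |midCorr w j k| ≤ 1 := by
  have h1 := abs_le.1 (hw.abs_distIncr_le_one j k)
  have h2 := abs_le.1 (hw.abs_distIncr_le_one j (k + 1))
  have h3 := hw.incr_nonneg j
  have h4 := hw.incr_le_one j
  rw [midCorr, abs_le]
  constructor <;> linarith [h1.1, h1.2, h2.1, h2.2]

theorem midCorr_self (hw : IsConcaveWeight w) (j : ℕ) : midCorr w j j = (w (j + 1) - w j) / 2 := by
  rw [midCorr, distIncr_of_ge le_rfl, distIncr_of_lt (Nat.lt_succ_self j)]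
  simp [hw.zero, hw.one]
  ring

theorem sum_abs_midCorr_self (hw : IsConcaveWeight w) (N : ℕ) :
    ∑ j ∈ Finset.range N, |midCorr w j j| = w N / 2 := by
  simp_rw [hw.midCorr_self, abs_of_nonneg (div_nonneg (hw.incr_nonneg _) zero_le_two)]
  rw [← Finset.sum_div, hw.sum_incr]

theorem sum_abs_midCorr_le (hw : IsConcaveWeight w) {k N : ℕ} (hk : k < N) :
    ∑ j ∈ Finset.range N, |midCorr w j k| ≤ 3 / 2 * w N := by
  have h1 := hw.sum_abs_distIncr_le hk.le
  have h2 := hw.sum_abs_distIncr_le (Nat.succ_le_of_lt hk)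
  have h3 := hw.sum_incr N
  have h : ∀ j ∈ Finset.range N, |midCorr w j k| ≤
      (2 * (w (j + 1) - w j) + |distIncr w j k| + |distIncr w j (k + 1)|) / 4 := by
    intro j _
    rw [midCorr, abs_div, abs_of_pos (by norm_num : (0 : ℝ) < 4)]
    gcongr
    refine (abs_sub _ _).trans (add_le_add ((abs_sub _ _).trans (add_le_add ?_ le_rfl)) le_rfl)
    rw [abs_of_nonneg (by linarith [hw.incr_nonneg j])]
  refine (Finset.sum_le_sum h).trans ?_
  rw [← Finset.sum_div, Finset.sum_add_distrib, Finset.sum_add_distrib, ← Finset.mul_sum, h3]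
  linarith

theorem incrCorr_comm (j k : ℕ) : incrCorr w j k = incrCorr w k j := by
  rw [incrCorr, incrCorr, Nat.dist_comm (j + 1) k, Nat.dist_comm j (k + 1), Nat.dist_comm j k]
  ring

theorem incrCorr_self (hw : IsConcaveWeight w) (j : ℕ) : incrCorr w j j = 1 := by
  rw [incrCorr, Nat.dist_self, Nat.dist_eq_sub_of_le_right (Nat.le_succ j),
    Nat.dist_eq_sub_of_le (Nat.le_succ j)]
  simp [hw.zero, hw.one]

/-- Off the diagonal the correlation is half a second difference of `w`, which concavity makes
nonpositive. This is where negatively correlated increments enter. -/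
theorem abs_incrCorr_of_lt (hw : IsConcaveWeight w) {j k : ℕ} (h : k < j) :
    |incrCorr w j k| = ((w (j - k) - w (j - k - 1)) - (w (j - k + 1) - w (j - k))) / 2 := by
  have hc := hw.concave (j - k - 1)
  rw [show j - k - 1 + 2 = j - k + 1 by omega, show j - k - 1 + 1 = j - k by omega] at hc
  rw [incrCorr, Nat.dist_eq_sub_of_le_right (by omega : k ≤ j + 1),
    Nat.dist_eq_sub_of_le_right (by omega : k + 1 ≤ j), Nat.dist_eq_sub_of_le_right h.le,
    show j + 1 - k = j - k + 1 by omega, show j - (k + 1) = j - k - 1 by omega,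
    abs_of_nonpos (by linarith)]
  ring

theorem sum_abs_incrCorr_le (hw : IsConcaveWeight w) (j N : ℕ) :
    ∑ k ∈ Finset.range N, |incrCorr w j k| ≤ 2 := by
  -- The second differences telescope on each side of the diagonal. Each side contributes at most
  -- 1/2 and the diagonal contributes 1; the intermediate bound keeps the boundary increment so that
  -- the induction closes.
  have key : ∑ k ∈ Finset.range N, |incrCorr w j k| ≤
      if N ≤ j then (w (j - N + 1) - w (j - N)) / 2
      else 2 - (w (N - 1 - j + 1) - w (N - 1 - j)) / 2 := by
    induction N with
    | zero => simpa using div_nonneg (hw.incr_nonneg j) zero_le_two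
    | succ N ih =>
      rw [Finset.sum_range_succ]
      rcases lt_trichotomy N j with h | h | h
      · rw [if_pos h.le] at ih
        rw [if_pos (Nat.succ_le_of_lt h), hw.abs_incrCorr_of_lt h,
          show j - (N + 1) + 1 = j - N by omega, show j - (N + 1) = j - N - 1 by omega]
        linarith
      · subst h
        rw [if_pos le_rfl] at ih
        rw [if_neg (by omega), hw.incrCorr_self]
        simp only [Nat.add_sub_cancel, Nat.sub_self, zero_add, hw.zero, hw.one, abs_one] at ih ⊢
        linarith
      · rw [if_neg (by omega)] at ih
        rw [if_neg (by omega), incrCorr_comm, hw.abs_incrCorr_of_lt h, Nat.add_sub_cancel]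
        rw [show N - 1 - j + 1 = N - j by omega, show N - 1 - j = N - j - 1 by omega] at ih
        linarith
  refine key.trans ?_
  split_ifs
  · linarith [hw.incr_le_one (j - N)]
  · linarith [hw.incr_nonneg (N - 1 - j)]

/-- In the product of midpoint terms, the second factor is at most `2 s` because `|midCorr| ≤ 1`;
the first is then summed over `j` by telescoping. For `s = n ^ (-H)` the quantity `s ^ 2 * w N` is
at most `t ^ (2 H)`, so the whole sum is of order `N`. -/
theorem sum_sum_le (hw : IsConcaveWeight w) (N : ℕ) {s : ℝ} (hs : 0 ≤ s) :
    ∑ j ∈ Finset.range N, ∑ k ∈ Finset.range N, (|incrCorr w j k| +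
      (s * |midCorr w j j| + s * |midCorr w j k|) * (s * |midCorr w k j| + s * |midCorr w k k|)) ≤
      N * (2 + 4 * (s ^ 2 * w N)) := by
  have h : ∀ j ∈ Finset.range N, ∀ k ∈ Finset.range N, |incrCorr w j k| +
      (s * |midCorr w j j| + s * |midCorr w j k|) * (s * |midCorr w k j| + s * |midCorr w k k|) ≤
      |incrCorr w j k| + 2 * s ^ 2 * (|midCorr w j j| + |midCorr w j k|) := by
    intro j _ k _
    have h1 := hw.abs_midCorr_le_one k j
    have h2 := hw.abs_midCorr_le_one k k
    have h3 : s * |midCorr w k j| + s * |midCorr w k k| ≤ s * 1 + s * 1 := by gcongr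
    have h4 : (s * |midCorr w j j| + s * |midCorr w j k|) *
      (s * |midCorr w k j| + s * |midCorr w k k|) ≤
      (s * |midCorr w j j| + s * |midCorr w j k|) * (s * 1 + s * 1) := by gcongr
    linarith
  refine (Finset.sum_le_sum fun j hj => Finset.sum_le_sum (h j hj)).trans ?_
  simp only [Finset.sum_add_distrib, ← Finset.mul_sum, mul_add]
  have s1 : ∑ j ∈ Finset.range N, ∑ k ∈ Finset.range N, |incrCorr w j k| ≤ N * 2 := by
    refine (Finset.sum_le_sum fun j _ => hw.sum_abs_incrCorr_le j N).trans_eq ?_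
    simp
  have s2 : ∑ j ∈ Finset.range N, ∑ k ∈ Finset.range N, |midCorr w j j| = N * (w N / 2) := by
    simp only [Finset.sum_const, Finset.card_range, nsmul_eq_mul]
    rw [← Finset.mul_sum, hw.sum_abs_midCorr_self]
  have s3 : ∑ j ∈ Finset.range N, ∑ k ∈ Finset.range N, |midCorr w j k| ≤ N * (3 / 2 * w N) := by
    rw [Finset.sum_comm]
    refine (Finset.sum_le_sum fun k hk => hw.sum_abs_midCorr_le (Finset.mem_range.1 hk)).trans_eq ?_
    simp
  rw [s2]
  have hs2 : 0 ≤ 2 * s ^ 2 := by positivity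
  have := mul_le_mul_of_nonneg_left s3 hs2
  linarith

end IsConcaveWeight

theorem isConcaveWeight_rpow {r : ℝ} (h0 : 0 < r) (h1 : r ≤ 1) :
    IsConcaveWeight (fun m : ℕ => (m : ℝ) ^ r) where
  zero := by simp [Real.zero_rpow h0.ne']
  one := by simp
  mono := fun a b hab => by
    have : (a : ℝ) ≤ b := by exact_mod_cast hab
    dsimp only
    gcongr
  concave m := by
    have := (Real.concaveOn_rpow h0.le h1).2 (show (m : ℝ) ∈ Set.Ici 0 from Set.mem_Ici.2 m.cast_nonneg)
      (show ((m + 2 : ℕ) : ℝ) ∈ Set.Ici 0 from Set.mem_Ici.2 (Nat.cast_nonneg _))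
      (by norm_num : (0 : ℝ) ≤ 1 / 2) (by norm_num : (0 : ℝ) ≤ 1 / 2) (by norm_num)
    simp only [smul_eq_mul] at this
    rw [show 1 / 2 * (m : ℝ) + 1 / 2 * ((m + 2 : ℕ) : ℝ) = ((m + 1 : ℕ) : ℝ) by push_cast; ring]
      at this
    linarith

/-! ### Covariances of fractional Brownian motion on the grid. -/

namespace IsFractionalBrownianMotion

variable {Ω : Type*} [MeasurableSpace Ω] {P : Measure Ω} {H : ℝ} {B : ℝ≥0 → Ω → ℝ}

theorem memLp_two (hB : IsFractionalBrownianMotion H B P) (s : ℝ≥0) : MemLp (B s) 2 P :=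
  (hB.isGaussianProcess.hasGaussianLaw_eval s).memLp_two

theorem cov_eq (hB : IsFractionalBrownianMotion H B P) (s t : ℝ≥0) :
    cov[B s, B t; P] =
      1 / 2 * ((s : ℝ) ^ (2 * H) + (t : ℝ) ^ (2 * H) - |(t : ℝ) - (s : ℝ)| ^ (2 * H)) := by
  have := hB.isGaussianProcess.isProbabilityMeasure
  rw [covariance_eq_sub (hB.memLp_two s) (hB.memLp_two t), hB.centered s, zero_mul, sub_zero]
  exact hB.covariance s t

theorem variance_eq (hB : IsFractionalBrownianMotion H B P) (hH : 0 < H) (s : ℝ≥0) :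
    Var[B s; P] = (s : ℝ) ^ (2 * H) := by
  rw [← covariance_self (hB.isGaussianProcess.aemeasurable s), hB.cov_eq]
  simp [Real.zero_rpow (by linarith : 2 * H ≠ 0)]
  ring

theorem variance_sub (hB : IsFractionalBrownianMotion H B P) (hH : 0 < H) (s t : ℝ≥0) :
    Var[fun ω => B t ω - B s ω; P] = |(t : ℝ) - (s : ℝ)| ^ (2 * H) := by
  have := hB.isGaussianProcess.isProbabilityMeasure
  have hs := hB.memLp_two s
  have ht := hB.memLp_two t
  have hd : MemLp (fun ω => B t ω - B s ω) 2 P := ht.sub hs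
  rw [← covariance_self hd.aemeasurable, covariance_fun_sub_left ht hs hd,
    covariance_fun_sub_right ht ht hs, covariance_fun_sub_right hs ht hs]
  simp only [hB.cov_eq, sub_self, abs_zero, Real.zero_rpow (by linarith : 2 * H ≠ 0)]
  rw [abs_sub_comm (s : ℝ) (t : ℝ)]
  ring

theorem ae_zero (hB : IsFractionalBrownianMotion H B P) (hH : 0 < H) : ∀ᵐ ω ∂P, B 0 ω = 0 := by
  have := hB.isGaussianProcess.isProbabilityMeasure
  have hv : Var[B 0; P] = 0 := by
    rw [hB.variance_eq hH]
    simp [Real.zero_rpow (by linarith : 2 * H ≠ 0)]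
  rw [variance_of_integral_eq_zero (hB.isGaussianProcess.aemeasurable 0) (hB.centered 0),
    integral_eq_zero_iff_of_nonneg (fun ω => sq_nonneg (B 0 ω)) (hB.memLp_two 0).integrable_sq] at hv
  filter_upwards [hv] with ω hω
  exact pow_eq_zero_iff two_ne_zero |>.1 hω

theorem integral_sub_eq_zero (hB : IsFractionalBrownianMotion H B P) (s t : ℝ≥0) :
    ∫ ω, (B t ω - B s ω) ∂P = 0 := by
  have i := fun s => (hB.isGaussianProcess.hasGaussianLaw_eval s).integrable
  rw [integral_sub (i t) (i s), hB.centered, hB.centered, sub_zero]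

/-- Moments of an increment weighted by `exp (x ^ 2 / (16 V))` at its endpoints scale like powers
of the mesh. -/
theorem exists_weighted_increment_bound (hB : IsFractionalBrownianMotion H B P) (hH : 0 < H)
    (p : ℕ) {V : ℝ} (hV : 0 < V) :
    ∃ C, 0 ≤ C ∧ ∀ (s r : ℝ≥0) (σ : ℝ), 0 < σ → (s : ℝ) ^ (2 * H) ≤ V → (r : ℝ) ^ (2 * H) ≤ V →
      |(r : ℝ) - (s : ℝ)| ^ (2 * H) ≤ σ ^ 2 →
      Integrable (fun ω => (Real.exp (1 / (16 * V) * B s ω ^ 2) +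
        Real.exp (1 / (16 * V) * B r ω ^ 2)) * |B r ω - B s ω| ^ p) P ∧
      ∫ ω, (Real.exp (1 / (16 * V) * B s ω ^ 2) +
        Real.exp (1 / (16 * V) * B r ω ^ 2)) * |B r ω - B s ω| ^ p ∂P ≤ C * σ ^ p := by
  -- The moment bound is applied to the increment divided by `σ`, whose variance is at most 1;
  -- undoing the scaling gives `σ ^ p`. The second power and the second weight are trivial, and the
  -- factor 2 below counts the two endpoints.
  obtain ⟨C, hC, hbd⟩ := exists_moment_bound P p 0 hV
    (f := fun x => Real.exp (1 / (16 * V) * x ^ 2)) (h := fun _ => 1) (by fun_prop) (by fun_prop)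
    ⟨1, fun x => by rw [abs_of_pos (Real.exp_pos _), one_mul, one_div_mul_eq_div]⟩
    ⟨1, fun x => by
      rw [abs_one, one_mul]
      exact Real.one_le_exp (by positivity)⟩
  refine ⟨2 * C, by positivity, fun s r σ hσ hs hr hsr => ?_⟩
  have hlaw : HasGaussianLaw (fun ω => σ⁻¹ * (B r ω - B s ω)) P :=
    (hB.isGaussianProcess.hasGaussianLaw_fun_sub (s := r) (t := s)).fun_smul σ⁻¹
  have hmean : ∫ ω, σ⁻¹ * (B r ω - B s ω) ∂P = 0 := by
    rw [integral_const_mul, hB.integral_sub_eq_zero, mul_zero]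
  have hvar : Var[fun ω => σ⁻¹ * (B r ω - B s ω); P] ≤ 1 := by
    rw [variance_const_mul, hB.variance_sub hH, inv_pow]
    exact inv_mul_le_one_of_le₀ hsr (by positivity)
  have hB1 := hB.isGaussianProcess.hasGaussianLaw_eval
  have hw : ∀ u : ℝ≥0, (u : ℝ) ^ (2 * H) ≤ V →
      Integrable (fun ω => Real.exp (1 / (16 * V) * B u ω ^ 2) * |B r ω - B s ω| ^ p) P ∧
      ∫ ω, Real.exp (1 / (16 * V) * B u ω ^ 2) * |B r ω - B s ω| ^ p ∂P ≤ C * σ ^ p := by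
    intro u hu
    have hvu : Var[B u; P] ≤ V := (hB.variance_eq hH u).trans_le hu
    obtain ⟨h1, h2⟩ := hbd _ _ _ _ hlaw hlaw (hB1 u) (hB1 u) hmean hmean (hB.centered u)
      (hB.centered u) hvar hvar hvu hvu
    have e : ∀ ω, Real.exp (1 / (16 * V) * B u ω ^ 2) * |B r ω - B s ω| ^ p =
        σ ^ p * |(σ⁻¹ * (B r ω - B s ω)) ^ p * (σ⁻¹ * (B r ω - B s ω)) ^ 0 *
          (Real.exp (1 / (16 * V) * B u ω ^ 2) * 1)| := by
      intro ω
      rw [pow_zero, mul_one, mul_one, abs_mul, abs_of_pos (Real.exp_pos _), abs_pow, abs_mul,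
        abs_of_pos (inv_pos.2 hσ), mul_pow, inv_pow]
      field_simp
    simp_rw [e]
    refine ⟨h1.abs.const_mul _, ?_⟩
    rw [integral_const_mul, mul_comm]
    gcongr
  obtain ⟨a1, a2⟩ := hw s hs
  obtain ⟨b1, b2⟩ := hw r hr
  simp_rw [add_mul]
  refine ⟨a1.add b1, ?_⟩
  rw [integral_add a1 b1]
  linarith

section Grid

/-- The normalized `j`-th increment on the grid of mesh `1 / n`. -/
noncomputable def gridIncr (H : ℝ) (B : ℝ≥0 → Ω → ℝ) (n j : ℕ) (ω : Ω) : ℝ :=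
  (n : ℝ) ^ H * (B (((j + 1 : ℕ) : ℝ≥0) / n) ω - B ((j : ℝ≥0) / n) ω)

/-- The midpoint value on the `j`-th step of the grid of mesh `1 / n`. -/
noncomputable def gridMid (B : ℝ≥0 → Ω → ℝ) (n j : ℕ) (ω : Ω) : ℝ :=
  1 / 2 * (B ((j : ℝ≥0) / n) ω + B (((j + 1 : ℕ) : ℝ≥0) / n) ω)

theorem cov_grid (hB : IsFractionalBrownianMotion H B P) {n : ℕ} (hn : 0 < n) (j k : ℕ) :
    cov[B ((j : ℝ≥0) / n), B ((k : ℝ≥0) / n); P] = 1 / 2 * ((n : ℝ) ^ (-H)) ^ 2 *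
      ((j : ℝ) ^ (2 * H) + (k : ℝ) ^ (2 * H) - (Nat.dist j k : ℝ) ^ (2 * H)) := by
  have hn' : (0 : ℝ) < n := by exact_mod_cast hn
  have hσ : ((n : ℝ) ^ (-H)) ^ 2 = ((n : ℝ) ^ (2 * H))⁻¹ := by
    rw [← Real.rpow_natCast, ← Real.rpow_mul hn'.le, ← Real.rpow_neg hn'.le]
    congr 1; push_cast; ring
  have hdist : |(k : ℝ) / n - (j : ℝ) / n| = (Nat.dist j k : ℝ) / n := by
    rw [← sub_div, abs_div, abs_of_pos hn']
    congr 1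
    rcases le_total j k with h | h
    · rw [Nat.dist_eq_sub_of_le h, Nat.cast_sub h, abs_of_nonneg]
      exact sub_nonneg.2 (by exact_mod_cast h)
    · rw [Nat.dist_eq_sub_of_le_right h, Nat.cast_sub h, abs_of_nonpos]
      · ring
      · exact sub_nonpos.2 (by exact_mod_cast h)
  rw [hB.cov_eq, hσ]
  push_cast
  rw [hdist, Real.div_rpow (by positivity) hn'.le, Real.div_rpow (by positivity) hn'.le,
    Real.div_rpow (by positivity) hn'.le]
  ring

theorem memLp_gridMid (hB : IsFractionalBrownianMotion H B P) (n j : ℕ) :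
    MemLp (gridMid B n j) 2 P :=
  ((hB.memLp_two _).add (hB.memLp_two _)).const_mul _

theorem cov_incr_grid (hB : IsFractionalBrownianMotion H B P) {n : ℕ} (hn : 0 < n) (j l : ℕ) :
    cov[gridIncr H B n j, B ((l : ℝ≥0) / n); P] = 1 / 2 * (n : ℝ) ^ (-H) *
      (((j + 1 : ℕ) : ℝ) ^ (2 * H) - (j : ℝ) ^ (2 * H)
        - distIncr (fun m : ℕ => (m : ℝ) ^ (2 * H)) j l) := by
  have := hB.isGaussianProcess.isProbabilityMeasure
  have hn' : (0 : ℝ) < n := by exact_mod_cast hn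
  have hσ : (n : ℝ) ^ H * (n : ℝ) ^ (-H) = 1 := by
    rw [← Real.rpow_add hn', add_neg_cancel, Real.rpow_zero]
  unfold gridIncr
  rw [covariance_const_mul_left,
    covariance_fun_sub_left (hB.memLp_two _) (hB.memLp_two _) (hB.memLp_two _),
    hB.cov_grid hn, hB.cov_grid hn, distIncr]
  generalize ((j + 1 : ℕ) : ℝ) ^ (2 * H) = a
  linear_combination (1 / 2 * (n : ℝ) ^ (-H) * (a - (j : ℝ) ^ (2 * H)
    - ((Nat.dist (j + 1) l : ℝ) ^ (2 * H) - (Nat.dist j l : ℝ) ^ (2 * H)))) * hσ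

theorem cov_gridIncr_gridMid (hB : IsFractionalBrownianMotion H B P) {n : ℕ} (hn : 0 < n)
    (j k : ℕ) :
    cov[gridIncr H B n j, gridMid B n k; P] =
      (n : ℝ) ^ (-H) * midCorr (fun m : ℕ => (m : ℝ) ^ (2 * H)) j k := by
  have := hB.isGaussianProcess.isProbabilityMeasure
  have hZ : MemLp (gridIncr H B n j) 2 P := ((hB.memLp_two _).sub (hB.memLp_two _)).const_mul _
  have e : gridMid B n k = fun ω => 1 / 2 *
    (B ((k : ℝ≥0) / n) + B (((k + 1 : ℕ) : ℝ≥0) / n)) ω := rfl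
  rw [e, covariance_const_mul_right, covariance_add_right hZ (hB.memLp_two _) (hB.memLp_two _),
    hB.cov_incr_grid hn, hB.cov_incr_grid hn, midCorr]
  ring

theorem cov_gridIncr_gridIncr (hB : IsFractionalBrownianMotion H B P) {n : ℕ} (hn : 0 < n)
    (j k : ℕ) :
    cov[gridIncr H B n j, gridIncr H B n k; P] =
      incrCorr (fun m : ℕ => (m : ℝ) ^ (2 * H)) j k := by
  have := hB.isGaussianProcess.isProbabilityMeasure
  have hn' : (0 : ℝ) < n := by exact_mod_cast hn
  have hσ : (n : ℝ) ^ H * (n : ℝ) ^ (-H) = 1 := by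
    rw [← Real.rpow_add hn', add_neg_cancel, Real.rpow_zero]
  have hZ : MemLp (gridIncr H B n j) 2 P := ((hB.memLp_two _).sub (hB.memLp_two _)).const_mul _
  have e : gridIncr H B n k = fun ω => (n : ℝ) ^ H *
    (B (((k + 1 : ℕ) : ℝ≥0) / n) ω - B ((k : ℝ≥0) / n) ω) := rfl
  rw [e, covariance_const_mul_right, covariance_fun_sub_right hZ (hB.memLp_two _) (hB.memLp_two _),
    hB.cov_incr_grid hn, hB.cov_incr_grid hn, incrCorr, distIncr, distIncr,
    Nat.dist_add_add_right j 1 k]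
  linear_combination ((((Nat.dist (j + 1) k : ℝ) ^ (2 * H) + (Nat.dist j (k + 1) : ℝ) ^ (2 * H)
    - 2 * (Nat.dist j k : ℝ) ^ (2 * H)) / 2)) * hσ

theorem variance_gridMid_le (hB : IsFractionalBrownianMotion H B P) (hH : 0 < H)
    (hH' : 2 * H ≤ 1) {n : ℕ} (hn : 0 < n) (j : ℕ) :
    Var[gridMid B n j; P] ≤ ((n : ℝ) ^ (-H)) ^ 2 * ((j + 1 : ℕ) : ℝ) ^ (2 * H) := by
  have := hB.isGaussianProcess.isProbabilityMeasure
  have hw := isConcaveWeight_rpow (by linarith : 0 < 2 * H) hH'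
  have hm : ((j : ℕ) : ℝ) ^ (2 * H) ≤ ((j + 1 : ℕ) : ℝ) ^ (2 * H) := hw.mono (Nat.le_succ j)
  have h1 := hB.memLp_two ((j : ℝ≥0) / n)
  have h2 := hB.memLp_two (((j + 1 : ℕ) : ℝ≥0) / n)
  have e : gridMid B n j = fun ω => 1 / 2 *
    (B ((j : ℝ≥0) / n) + B (((j + 1 : ℕ) : ℝ≥0) / n)) ω := rfl
  rw [← covariance_self (hB.memLp_gridMid n j).aemeasurable]
  rw [e, covariance_const_mul_right, covariance_const_mul_left,
    covariance_add_left h1 h2 (h1.add h2), covariance_add_right h1 h1 h2,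
    covariance_add_right h2 h1 h2]
  have hdist : Nat.dist j (j + 1) = 1 := by
    rw [Nat.dist_eq_sub_of_le (Nat.le_succ j)]; omega
  simp only [hB.cov_grid hn, Nat.dist_self, Nat.cast_zero,
    Real.zero_rpow (by linarith : 2 * H ≠ 0), Nat.dist_comm (j + 1) j, hdist, Nat.cast_one,
    Real.one_rpow]
  have hs : 0 ≤ ((n : ℝ) ^ (-H)) ^ 2 := by positivity
  generalize ((j + 1 : ℕ) : ℝ) ^ (2 * H) = b at *
  generalize (j : ℝ) ^ (2 * H) = a at *
  generalize ((n : ℝ) ^ (-H)) ^ 2 = s at *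
  have := mul_le_mul_of_nonneg_left hm hs
  linarith

theorem isGaussianQuad_grid (hB : IsFractionalBrownianMotion H B P) (hH : 0 < H)
    (hH' : 2 * H ≤ 1) {n : ℕ} (hn : 0 < n) {V : ℝ} {j k : ℕ}
    (hj : ((n : ℝ) ^ (-H)) ^ 2 * ((j + 1 : ℕ) : ℝ) ^ (2 * H) ≤ V)
    (hk : ((n : ℝ) ^ (-H)) ^ 2 * ((k + 1 : ℕ) : ℝ) ^ (2 * H) ≤ V) :
    IsGaussianQuad P V (gridIncr H B n j) (gridIncr H B n k) (gridMid B n j) (gridMid B n k) := by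
  have hw := isConcaveWeight_rpow (by linarith : 0 < 2 * H) hH'
  have hi := fun s => (hB.isGaussianProcess.hasGaussianLaw_eval s).integrable
  have mZ : ∀ j, ∫ ω, gridIncr H B n j ω ∂P = 0 := fun j => by
    unfold gridIncr; rw [integral_const_mul, hB.integral_sub_eq_zero, mul_zero]
  have mY : ∀ j, ∫ ω, gridMid B n j ω ∂P = 0 := fun j => by
    unfold gridMid
    rw [integral_const_mul, integral_add (hi _) (hi _), hB.centered, hB.centered]; simp
  have vZ : ∀ j, Var[gridIncr H B n j; P] = 1 := fun j => by
    have hZ : MemLp (gridIncr H B n j) 2 P := ((hB.memLp_two _).sub (hB.memLp_two _)).const_mul _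
    rw [← covariance_self hZ.aemeasurable, hB.cov_gridIncr_gridIncr hn, hw.incrCorr_self]
  refine ⟨?_, mZ j, mZ k, mY j, mY k, vZ j, vZ k, (hB.variance_gridMid_le hH hH' hn j).trans hj,
    (hB.variance_gridMid_le hH hH' hn k).trans hk⟩
  classical
  -- Indexing the four times by `Fin 4` allows them to coincide, as happens for equal or adjacent
  -- steps.
  let T : Fin 4 → ℝ≥0 := ![(j : ℝ≥0) / n, ((j + 1 : ℕ) : ℝ≥0) / n, (k : ℝ≥0) / n,
    ((k + 1 : ℕ) : ℝ≥0) / n]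
  have hlaw := (hB.isGaussianProcess.comp_right T).hasGaussianLaw Finset.univ
  let pr : Fin 4 → ({x // x ∈ (Finset.univ : Finset (Fin 4))} → ℝ) →L[ℝ] ℝ := fun i =>
    ContinuousLinearMap.proj ⟨i, Finset.mem_univ i⟩
  exact hlaw.map (((n : ℝ) ^ H • (pr 1 - pr 0)).prod (((n : ℝ) ^ H • (pr 3 - pr 2)).prod
    (((1 / 2 : ℝ) • (pr 0 + pr 1)).prod ((1 / 2 : ℝ) • (pr 2 + pr 3)))))

end Grid

end IsFractionalBrownianMotion

/-! ### Convergence criteria and mean bounds for the odd sums. -/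

theorem integral_abs_le_sqrt {Ω : Type*} [MeasurableSpace Ω] {P : Measure Ω}
    [IsProbabilityMeasure P] {S : Ω → ℝ} (hS : MemLp S 2 P) {M : ℝ} (h : ∫ ω, S ω ^ 2 ∂P ≤ M) :
    ∫ ω, |S ω| ∂P ≤ √M := by
  have h1 := variance_nonneg |S| P
  rw [variance_eq_sub hS.abs] at h1
  simp only [Pi.pow_apply, Pi.abs_apply, sq_abs] at h1
  exact Real.le_sqrt_of_sq_le (by linarith)

/-- A sequence that is dominated in mean by a null sequence converges in measure. -/
theorem tendstoInMeasure_of_integral_bound {Ω : Type*} [MeasurableSpace Ω] {P : Measure Ω}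
    {F : ℕ → Ω → ℝ} {G : Ω → ℝ} (hF : ∀ n, AEStronglyMeasurable (F n) P)
    (hG : AEStronglyMeasurable G P) {β : ℕ → ℝ} (hβ : Tendsto β atTop (nhds 0))
    (h : ∀ᶠ n in atTop, ∃ D : Ω → ℝ, Integrable D P ∧ (∀ᵐ ω ∂P, |F n ω - G ω| ≤ D ω) ∧
      ∫ ω, D ω ∂P ≤ β n) :
    TendstoInMeasure P F atTop G := by
  refine tendstoInMeasure_of_tendsto_eLpNorm one_ne_zero hF hG ?_
  have hlim : Tendsto (fun n => ENNReal.ofReal (β n)) atTop (nhds 0) := by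
    simpa using ENNReal.tendsto_ofReal hβ
  refine tendsto_of_tendsto_of_tendsto_of_le_of_le' tendsto_const_nhds hlim
    (Eventually.of_forall fun _ => zero_le) ?_
  filter_upwards [h] with n hn
  obtain ⟨D, hD, hle, hint⟩ := hn
  have hD0 : 0 ≤ᵐ[P] D := hle.mono fun ω hω => (abs_nonneg _).trans hω
  rw [eLpNorm_one_eq_lintegral_enorm]
  calc ∫⁻ ω, ‖(F n - G) ω‖ₑ ∂P ≤ ∫⁻ ω, ENNReal.ofReal (D ω) ∂P := by
        refine lintegral_mono_ae (hle.mono fun ω hω => ?_)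
        rw [← ofReal_norm]
        exact ENNReal.ofReal_le_ofReal hω
    _ = ENNReal.ofReal (∫ ω, D ω ∂P) := (ofReal_integral_eq_lintegral_ofReal hD hD0).symm
    _ ≤ ENNReal.ofReal (β n) := ENNReal.ofReal_le_ofReal hint

theorem grid_le {t : ℝ≥0} {n m : ℕ} (hn : 0 < n) (hm : m ≤ ⌊(n : ℝ≥0) * t⌋₊) :
    (m : ℝ) / n ≤ t := by
  have hn' : (0 : ℝ) < n := by exact_mod_cast hn
  have h : (m : ℝ≥0) ≤ n * t := (Nat.le_floor_iff zero_le).1 hm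
  rw [div_le_iff₀ hn', mul_comm]
  exact_mod_cast h

theorem grid_weight_le {H : ℝ} (hH : 0 < H) {t : ℝ≥0} {n m : ℕ} (hn : 0 < n)
    (hm : m ≤ ⌊(n : ℝ≥0) * t⌋₊) : ((n : ℝ) ^ (-H)) ^ 2 * (m : ℝ) ^ (2 * H) ≤ (t : ℝ) ^ (2 * H) := by
  have hn' : (0 : ℝ) < n := by exact_mod_cast hn
  have hσ : ((n : ℝ) ^ (-H)) ^ 2 = ((n : ℝ) ^ (2 * H))⁻¹ := by
    rw [← Real.rpow_natCast, ← Real.rpow_mul hn'.le, ← Real.rpow_neg hn'.le]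
    congr 1; push_cast; ring
  rw [hσ, inv_mul_eq_div, ← Real.div_rpow (by positivity) hn'.le]
  exact Real.rpow_le_rpow (by positivity) (grid_le hn hm) (by linarith)

namespace IsFractionalBrownianMotion

variable {Ω : Type*} [MeasurableSpace Ω] {P : Measure Ω} {H : ℝ} {B : ℝ≥0 → Ω → ℝ}

/-- Midpoint sums of odd powers of the increments. -/
noncomputable def oddSum (B : ℝ≥0 → Ω → ℝ) (f : ℝ → ℝ) (p : ℕ) (t : ℝ≥0) (n : ℕ) (ω : Ω) : ℝ :=
  ∑ j ∈ Finset.range ⌊(n : ℝ≥0) * t⌋₊,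
    f (gridMid B n j ω) * (B (((j + 1 : ℕ) : ℝ≥0) / n) ω - B ((j : ℝ≥0) / n) ω) ^ p

/-- The square of the sum is a double sum of mixed moments with both exponents odd. These are
bounded by `exists_bound_of_odd_of_odd` and summed by `IsConcaveWeight.sum_sum_le`, so the diagonal
order `n` is not exceeded. -/
theorem exists_oddSum_bound (hB : IsFractionalBrownianMotion H B P) (hH : 0 < H) (hH' : 2 * H ≤ 1)
    (a : ℕ) {f : ℝ → ℝ} (hf : SmoothSubGaussian f) (t : ℝ≥0) :
    ∃ C, 0 ≤ C ∧ ∀ n : ℕ, 0 < n →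
      Integrable (oddSum B f (2 * a + 1) t n) P ∧
      ∫ ω, |oddSum B f (2 * a + 1) t n ω| ∂P ≤
        √(C * (n * ((n : ℝ) ^ (-H)) ^ (2 * (2 * a + 1)))) := by
  have := hB.isGaussianProcess.isProbabilityMeasure
  have hw := isConcaveWeight_rpow (by linarith : 0 < 2 * H) hH'
  -- The added 1 keeps `V` positive when `t = 0`.
  set V : ℝ := (t : ℝ) ^ (2 * H) + 1 with hVdef
  have ht0 : 0 ≤ (t : ℝ) ^ (2 * H) := by positivity
  have hV : 0 < V := by positivity
  obtain ⟨C, hC, HC⟩ := exists_bound_of_odd_of_odd P hV a a hf hf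
  -- The witness is the bound of `sum_sum_le` with `N ≤ n t` and `σ ^ 2 * N ^ (2 H) ≤ t ^ (2 H)`
  -- inserted.
  refine ⟨C * (t * (2 + 4 * (t : ℝ) ^ (2 * H))), by positivity, fun n hn => ?_⟩
  have hn' : (0 : ℝ) < n := by exact_mod_cast hn
  have hn1 : (1 : ℝ) ≤ n := by exact_mod_cast hn
  set N := ⌊(n : ℝ≥0) * t⌋₊ with hN
  set σ : ℝ := (n : ℝ) ^ (-H) with hσdef
  have hσ0 : 0 < σ := Real.rpow_pos_of_pos hn' _
  have hσ1 : σ ≤ 1 := Real.rpow_le_one_of_one_le_of_nonpos hn1 (by linarith)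
  have hσn : σ * (n : ℝ) ^ H = 1 := by
    rw [hσdef, ← Real.rpow_add hn', neg_add_cancel, Real.rpow_zero]
  have hstep : ∀ j ω, B (((j + 1 : ℕ) : ℝ≥0) / n) ω - B ((j : ℝ≥0) / n) ω =
      σ * gridIncr H B n j ω := by
    intro j ω
    rw [gridIncr, ← mul_assoc, hσn, one_mul]
  have hwt : ∀ m ≤ N, σ ^ 2 * (m : ℝ) ^ (2 * H) ≤ V := fun m hm =>
    (grid_weight_le hH hn hm).trans (by linarith)
  have hquad : ∀ j ∈ Finset.range N, ∀ k ∈ Finset.range N, IsGaussianQuad P V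
      (gridIncr H B n j) (gridIncr H B n k) (gridMid B n j) (gridMid B n k) :=
    fun j hj k hk => hB.isGaussianQuad_grid hH hH' hn
      (hwt _ (Nat.succ_le_of_lt (Finset.mem_range.1 hj)))
      (hwt _ (Nat.succ_le_of_lt (Finset.mem_range.1 hk)))
  set p := 2 * a + 1 with hp
  have hsq : ∀ ω, oddSum B f p t n ω ^ 2 = ∑ j ∈ Finset.range N, ∑ k ∈ Finset.range N,
      σ ^ (2 * p) * (gridIncr H B n j ω ^ p * gridIncr H B n k ω ^ p *
        (f (gridMid B n j ω) * f (gridMid B n k ω))) := by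
    intro ω
    rw [oddSum, sq, Finset.sum_mul_sum]
    refine Finset.sum_congr rfl fun j _ => Finset.sum_congr rfl fun k _ => ?_
    rw [hstep, hstep]
    ring
  have hint : ∀ j ∈ Finset.range N, ∀ k ∈ Finset.range N, Integrable (fun ω =>
      σ ^ (2 * p) * (gridIncr H B n j ω ^ p * gridIncr H B n k ω ^ p *
        (f (gridMid B n j ω) * f (gridMid B n k ω)))) P := fun j hj k hk =>
    ((hquad j hj k hk).integrable hV hf hf p p).const_mul _
  have hsqint : Integrable (fun ω => oddSum B f p t n ω ^ 2) P := by
    simp_rw [hsq]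
    exact integrable_finsetSum _ fun j hj => integrable_finsetSum _ fun k hk => hint j hj k hk
  have hmeas : AEStronglyMeasurable (oddSum B f p t n) P := by
    unfold oddSum
    refine Finset.aestronglyMeasurable_fun_sum _ fun j _ => ?_
    have m := hB.isGaussianProcess.aemeasurable
    exact ((hf.measurable.comp_aemeasurable (hB.memLp_gridMid n j).aemeasurable).mul
      (((m _).sub (m _)).pow_const p)).aestronglyMeasurable
  have hLp : MemLp (oddSum B f p t n) 2 P := (memLp_two_iff_integrable_sq hmeas).2 hsqint
  refine ⟨hLp.integrable one_le_two, integral_abs_le_sqrt hLp ?_⟩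
  have hmom : ∀ j ∈ Finset.range N, ∀ k ∈ Finset.range N,
      ∫ ω, σ ^ (2 * p) * (gridIncr H B n j ω ^ p * gridIncr H B n k ω ^ p *
        (f (gridMid B n j ω) * f (gridMid B n k ω))) ∂P ≤
      σ ^ (2 * p) * (C * (|incrCorr (fun m : ℕ => (m : ℝ) ^ (2 * H)) j k| +
        (σ * |midCorr (fun m : ℕ => (m : ℝ) ^ (2 * H)) j j| +
          σ * |midCorr (fun m : ℕ => (m : ℝ) ^ (2 * H)) j k|) *
        (σ * |midCorr (fun m : ℕ => (m : ℝ) ^ (2 * H)) k j| +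
          σ * |midCorr (fun m : ℕ => (m : ℝ) ^ (2 * H)) k k|))) := by
    intro j hj k hk
    rw [integral_const_mul]
    gcongr
    have hcov : ∀ i l, |cov[gridIncr H B n i, gridMid B n l; P]| =
        σ * |midCorr (fun m : ℕ => (m : ℝ) ^ (2 * H)) i l| := fun i l => by
      rw [hB.cov_gridIncr_gridMid hn, abs_mul, abs_of_pos hσ0]
    have hle : ∀ i l, |cov[gridIncr H B n i, gridMid B n l; P]| ≤ 1 := fun i l => by
      rw [hcov]
      exact mul_le_one₀ hσ1 (abs_nonneg _) (hw.abs_midCorr_le_one i l)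
    have := HC _ _ _ _ (hquad j hj k hk) (hle j j) (hle j k)
    rw [hcov, hcov, hcov, hcov, hB.cov_gridIncr_gridIncr hn] at this
    exact (le_abs_self _).trans this
  simp_rw [hsq]
  rw [integral_finsetSum _ fun j hj => integrable_finsetSum _ fun k hk => hint j hj k hk]
  have h1 : ∑ j ∈ Finset.range N, ∫ ω, ∑ k ∈ Finset.range N,
      σ ^ (2 * p) * (gridIncr H B n j ω ^ p * gridIncr H B n k ω ^ p *
        (f (gridMid B n j ω) * f (gridMid B n k ω))) ∂P ≤
      σ ^ (2 * p) * (C * (N * (2 + 4 * (σ ^ 2 * (N : ℝ) ^ (2 * H))))) := by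
    have hsum := mul_le_mul_of_nonneg_left (mul_le_mul_of_nonneg_left (hw.sum_sum_le N hσ0.le) hC)
      (by positivity : 0 ≤ σ ^ (2 * p))
    simp only [Finset.mul_sum] at hsum
    refine (Finset.sum_le_sum fun j hj => ?_).trans hsum
    rw [integral_finsetSum _ fun k hk => hint j hj k hk]
    exact Finset.sum_le_sum (hmom j hj)
  refine h1.trans ?_
  have hNt : (N : ℝ) ≤ n * t := by
    have := grid_le (t := t) hn (le_refl N)
    rwa [div_le_iff₀ hn', mul_comm] at this
  have hwN := grid_weight_le hH hn (le_refl N)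
  calc σ ^ (2 * p) * (C * (N * (2 + 4 * (σ ^ 2 * (N : ℝ) ^ (2 * H)))))
      ≤ σ ^ (2 * p) * (C * ((n * t) * (2 + 4 * (t : ℝ) ^ (2 * H)))) := by gcongr
    _ = _ := by ring

theorem aestronglyMeasurable_simpsonSum (hB : IsFractionalBrownianMotion H B P) {g : ℝ → ℝ}
    (hg : Measurable (deriv g)) (t : ℝ≥0) (n : ℕ) :
    AEStronglyMeasurable (fun ω => simpsonSum g (fun s => B s ω) t n) P := by
  have m := hB.isGaussianProcess.aemeasurable
  have := hg
  unfold simpsonSum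
  refine Finset.aestronglyMeasurable_fun_sum _ fun j _ => AEMeasurable.aestronglyMeasurable ?_
  fun_prop

end IsFractionalBrownianMotion

/-! ### Assembly of the error estimate and conclusion. -/

/-- The sequence is `n ^ (1 - 10 H)`: the threshold 1/10 enters here. -/
theorem tendsto_mul_rpow_neg_pow {H : ℝ} (hH : 1 / 10 < H) :
    Tendsto (fun n : ℕ => (n : ℝ) * ((n : ℝ) ^ (-H)) ^ 10) atTop (nhds 0) := by
  have h := (tendsto_rpow_neg_atTop (by linarith : 0 < 10 * H - 1)).comp tendsto_natCast_atTop_atTop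
  refine h.congr' ?_
  filter_upwards [eventually_gt_atTop 0] with n hn
  have hn' : (0 : ℝ) < n := by exact_mod_cast hn
  simp only [Function.comp_apply]
  rw [← Real.rpow_natCast, ← Real.rpow_mul hn'.le]
  nth_rewrite 2 [← Real.rpow_one (n : ℝ)]
  rw [← Real.rpow_add hn']
  congr 1; push_cast; ring

/-- Pathwise bound for the error of Simpson's rule on `[0, t]`. -/
theorem abs_simpsonSum_sub_le {g : ℝ → ℝ} (hg : ContDiff ℝ (⊤ : ℕ∞) g) {ε C₁ C₁₀ : ℝ} (hε : 0 ≤ ε)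
    (h₁ : ∀ x, |deriv g x| ≤ C₁ * Real.exp (ε * x ^ 2))
    (h₁₀ : ∀ x, |iteratedDeriv 10 g x| ≤ C₁₀ * Real.exp (ε * x ^ 2))
    (hC₁ : 0 ≤ C₁) (hC₁₀ : 0 ≤ C₁₀) {Ω : Type*} (B : ℝ≥0 → Ω → ℝ) (t : ℝ≥0) (n : ℕ) {ω : Ω}
    (h0 : B 0 ω = 0) :
    |simpsonSum g (fun s => B s ω) t n - (g (B t ω) - g 0)| ≤
      1 / 2880 * |IsFractionalBrownianMotion.oddSum B (iteratedDeriv 5 g) 5 t n ω|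
      + 1 / 241920 * |IsFractionalBrownianMotion.oddSum B (iteratedDeriv 7 g) 7 t n ω|
      + 1 / 46448640 * |IsFractionalBrownianMotion.oddSum B (iteratedDeriv 9 g) 9 t n ω|
      + C₁₀ * ∑ j ∈ Finset.range ⌊(n : ℝ≥0) * t⌋₊,
        (Real.exp (ε * B ((j : ℝ≥0) / n) ω ^ 2) +
          Real.exp (ε * B (((j + 1 : ℕ) : ℝ≥0) / n) ω ^ 2)) *
          |B (((j + 1 : ℕ) : ℝ≥0) / n) ω - B ((j : ℝ≥0) / n) ω| ^ 10
      + C₁ * ((Real.exp (ε * B ((⌊(n : ℝ≥0) * t⌋₊ : ℝ≥0) / n) ω ^ 2) +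
          Real.exp (ε * B t ω ^ 2)) * |B t ω - B ((⌊(n : ℝ≥0) * t⌋₊ : ℝ≥0) / n) ω| ^ 1) := by
  set N := ⌊(n : ℝ≥0) * t⌋₊
  set X : ℕ → ℝ := fun j => B ((j : ℝ≥0) / n) ω with hX
  have hbd : ∀ {k : ℕ} {C : ℝ}, 0 ≤ C → (∀ x, |iteratedDeriv k g x| ≤ C * Real.exp (ε * x ^ 2)) →
      ∀ a b : ℝ, ∀ x ∈ Set.uIcc a b, |iteratedDeriv k g x| ≤
        C * (Real.exp (ε * a ^ 2) + Real.exp (ε * b ^ 2)) := fun hC h a b x hx =>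
    (h x).trans (mul_le_mul_of_nonneg_left (exp_mul_sq_le_of_mem_uIcc hε hx) hC)
  have hend : |g (B t ω) - g (X N)| ≤
      C₁ * ((Real.exp (ε * X N ^ 2) + Real.exp (ε * B t ω ^ 2)) * |B t ω - X N| ^ 1) := by
    rw [pow_one, ← mul_assoc]
    refine abs_sub_le_of_deriv_bound (hg.differentiable (by simp)) fun x hx => ?_
    have := hbd (k := 1) hC₁ (by simpa [iteratedDeriv_one] using h₁) _ _ x hx
    rwa [iteratedDeriv_one] at this
  set R : ℕ → ℝ := fun j =>
    1 / 6 * (deriv g (X j) + 4 * deriv g (1 / 2 * (X j + X (j + 1))) + deriv g (X (j + 1))) *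
      (X (j + 1) - X j) - (g (X (j + 1)) - g (X j))
      - (1 / 2880 * (iteratedDeriv 5 g (1 / 2 * (X j + X (j + 1))) * (X (j + 1) - X j) ^ 5)
        + 1 / 241920 * (iteratedDeriv 7 g (1 / 2 * (X j + X (j + 1))) * (X (j + 1) - X j) ^ 7)
        + 1 / 46448640 * (iteratedDeriv 9 g (1 / 2 * (X j + X (j + 1))) * (X (j + 1) - X j) ^ 9))
    with hR
  have hRle : ∀ j, |R j| ≤ C₁₀ * ((Real.exp (ε * X j ^ 2) + Real.exp (ε * X (j + 1) ^ 2)) *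
      |X (j + 1) - X j| ^ 10) := fun j => by
    rw [← mul_assoc]
    exact abs_simpson_error_le hg (hbd hC₁₀ h₁₀ _ _)
  -- The increments of `g` along the grid telescope to `g (X N) - g 0`, using `B 0 ω = 0`; the last
  -- term corrects for the grid stopping at `N / n` instead of `t`.
  have hdecomp : simpsonSum g (fun s => B s ω) t n - (g (B t ω) - g 0) =
      1 / 2880 * IsFractionalBrownianMotion.oddSum B (iteratedDeriv 5 g) 5 t n ω
      + 1 / 241920 * IsFractionalBrownianMotion.oddSum B (iteratedDeriv 7 g) 7 t n ω
      + 1 / 46448640 * IsFractionalBrownianMotion.oddSum B (iteratedDeriv 9 g) 9 t n ω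
      + ∑ j ∈ Finset.range N, R j - (g (B t ω) - g (X N)) := by
    have htel := Finset.sum_range_sub (fun j => g (X j)) N
    have hX0 : X 0 = 0 := by simp [hX, h0]
    have hS : simpsonSum g (fun s => B s ω) t n = ∑ j ∈ Finset.range N,
        1 / 6 * (deriv g (X j) + 4 * deriv g (1 / 2 * (X j + X (j + 1))) + deriv g (X (j + 1))) *
          (X (j + 1) - X j) := by
      simp only [simpsonSum, hX, Nat.cast_add, Nat.cast_one, N]
    have hO : ∀ (f : ℝ → ℝ) (p : ℕ), IsFractionalBrownianMotion.oddSum B f p t n ω =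
        ∑ j ∈ Finset.range N, f (1 / 2 * (X j + X (j + 1))) * (X (j + 1) - X j) ^ p :=
      fun f p => rfl
    rw [hX0] at htel
    rw [hS, hO, hO, hO]
    simp only [hR, Finset.sum_sub_distrib, Finset.sum_add_distrib, ← Finset.mul_sum] at htel ⊢
    linarith
  rw [hdecomp]
  refine (abs_sub _ _).trans (add_le_add ((abs_add_le _ _).trans (add_le_add
    ((abs_add_le _ _).trans (add_le_add ((abs_add_le _ _).trans (add_le_add ?_ ?_)) ?_)) ?_)) hend)
  · rw [abs_mul, abs_of_pos (by norm_num : (0 : ℝ) < 1 / 2880)]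
  · rw [abs_mul, abs_of_pos (by norm_num : (0 : ℝ) < 1 / 241920)]
  · rw [abs_mul, abs_of_pos (by norm_num : (0 : ℝ) < 1 / 46448640)]
  · rw [Finset.mul_sum]
    exact (Finset.abs_sum_le_sum_abs _ _).trans (Finset.sum_le_sum fun j _ => hRle j)

theorem tendsto_error_bound {x y : ℕ → ℝ} (hx : Tendsto x atTop (nhds 0))
    (hy : Tendsto y atTop (nhds 0)) (a₁ a₂ a₃ a₄ a₅ K₁ K₂ K₃ K₄ K₅ : ℝ) :
    Tendsto (fun n => a₁ * √(K₁ * x n) + a₂ * √(K₂ * x n) + a₃ * √(K₃ * x n)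
      + a₄ * (K₄ * x n) + a₅ * (K₅ * y n)) atTop (nhds 0) := by
  have hs : ∀ K : ℝ, Tendsto (fun n => √(K * x n)) atTop (nhds 0) := fun K => by
    simpa using (hx.const_mul K).sqrt
  have h := (((((hs K₁).const_mul a₁).add ((hs K₂).const_mul a₂)).add
    ((hs K₃).const_mul a₃)).add ((hx.const_mul K₄).const_mul a₄)).add
    ((hy.const_mul K₅).const_mul a₅)
  simpa only [mul_zero, add_zero] using h

theorem proposition3p1 {Ω : Type*} [MeasurableSpace Ω] (P : Measure Ω)
    (H : ℝ) (hH₁ : 1 / 10 < H) (hH₂ : H < 1 / 2)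
    (B : ℝ≥0 → Ω → ℝ) (hB : IsFractionalBrownianMotion H B P)
    (g : ℝ → ℝ) (hg : ContDiff ℝ (⊤ : ℕ∞) g) (hgrowth : ∀ k : ℕ, ModerateGrowth (iteratedDeriv k g))
    (t : ℝ≥0) :
    TendstoInMeasure P (fun (n : ℕ) (ω : Ω) => simpsonSum g (fun s => B s ω) t n) atTop
      (fun ω => g (B t ω) - g 0) := by
  have hH : 0 < H := by linarith
  have hH' : 2 * H ≤ 1 := by linarith
  have hgS := smoothSubGaussian_of_moderateGrowth hg hgrowth
  set V : ℝ := (t : ℝ) ^ (2 * H) + 1 with hVdef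
  have ht0 : 0 ≤ (t : ℝ) ^ (2 * H) := by positivity
  have hV : 0 < V := by positivity
  -- This is the rate for which the weights `exp (ε x ^ 2)` match `exists_weighted_increment_bound`.
  set ε : ℝ := 1 / (16 * V) with hεdef
  have hε : 0 < ε := by positivity
  have hpos : ∀ {f : ℝ → ℝ} {C : ℝ}, (∀ x, |f x| ≤ C * Real.exp (ε * x ^ 2)) → 0 ≤ C := by
    intro f C h
    simpa using (abs_nonneg _).trans (h 0)
  obtain ⟨C₁, h₁⟩ := hgS.deriv.bound 0 ε hε
  rw [iteratedDeriv_zero] at h₁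
  obtain ⟨C₁₀, h₁₀⟩ := hgS.bound 10 ε hε
  have hC₁ := hpos h₁
  have hC₁₀ := hpos h₁₀
  obtain ⟨K₅, hK₅, b₅⟩ := hB.exists_oddSum_bound hH hH' 2 (hgS.iteratedDeriv 5) t
  obtain ⟨K₇, hK₇, b₇⟩ := hB.exists_oddSum_bound hH hH' 3 (hgS.iteratedDeriv 7) t
  obtain ⟨K₉, hK₉, b₉⟩ := hB.exists_oddSum_bound hH hH' 4 (hgS.iteratedDeriv 9) t
  obtain ⟨L, hL, bL⟩ := hB.exists_weighted_increment_bound hH 10 hV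
  obtain ⟨E, hE, bE⟩ := hB.exists_weighted_increment_bound hH 1 hV
  set x : ℕ → ℝ := fun n => (n : ℝ) * ((n : ℝ) ^ (-H)) ^ 10 with hx
  have hxlim : Tendsto x atTop (nhds 0) := tendsto_mul_rpow_neg_pow hH₁
  have hσlim : Tendsto (fun n : ℕ => (n : ℝ) ^ (-H)) atTop (nhds 0) :=
    (tendsto_rpow_neg_atTop hH).comp tendsto_natCast_atTop_atTop
  have hβ : Tendsto (fun n : ℕ => 1 / 2880 * √(K₅ * x n) + 1 / 241920 * √(K₇ * x n)
      + 1 / 46448640 * √(K₉ * x n) + C₁₀ * (t * L * x n) + C₁ * (E * (n : ℝ) ^ (-H)))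
      atTop (nhds 0) :=
    tendsto_error_bound hxlim hσlim _ _ _ _ _ _ _ _ _ _
  refine tendstoInMeasure_of_integral_bound
    (hB.aestronglyMeasurable_simpsonSum hgS.deriv.measurable t)
    (((hgS.measurable.comp_aemeasurable (hB.isGaussianProcess.aemeasurable t)).sub_const
      (g 0)).aestronglyMeasurable) hβ ?_
  filter_upwards [eventually_gt_atTop 0] with n hn
  have hn' : (0 : ℝ) < n := by exact_mod_cast hn
  have hn1 : (1 : ℝ) ≤ n := by exact_mod_cast hn
  obtain ⟨i₅, j₅⟩ := b₅ n hn
  obtain ⟨i₇, j₇⟩ := b₇ n hn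
  obtain ⟨i₉, j₉⟩ := b₉ n hn
  set N := ⌊(n : ℝ≥0) * t⌋₊ with hN
  set σ : ℝ := (n : ℝ) ^ (-H) with hσdef
  have hσ0 : 0 < σ := Real.rpow_pos_of_pos hn' _
  have hσ1 : σ ≤ 1 := Real.rpow_le_one_of_one_le_of_nonpos hn1 (by linarith)
  have hσ2 : (1 / (n : ℝ)) ^ (2 * H) = σ ^ 2 := by
    rw [one_div, Real.inv_rpow hn'.le, ← Real.rpow_neg hn'.le, hσdef, ← Real.rpow_natCast,
      ← Real.rpow_mul hn'.le]
    congr 1; push_cast; ring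
  have hgrid : ∀ m ≤ N, (((m : ℝ≥0) / n : ℝ≥0) : ℝ) ^ (2 * H) ≤ V := fun m hm => by
    have h := Real.rpow_le_rpow (z := 2 * H) (by positivity) (grid_le hn hm) (by linarith)
    push_cast
    linarith
  have bstep : ∀ j ∈ Finset.range N, _ := fun j hj =>
    bL ((j : ℝ≥0) / n) (((j + 1 : ℕ) : ℝ≥0) / n) σ hσ0
      (hgrid j (Finset.mem_range.1 hj).le) (hgrid _ (Nat.succ_le_of_lt (Finset.mem_range.1 hj)))
      (by
        rw [← hσ2]
        refine le_of_eq (congrArg (· ^ (2 * H)) ?_)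
        push_cast
        rw [← sub_div, add_sub_cancel_left, abs_of_pos (by positivity)])
  -- The last, incomplete step has length at most `1 / n`, so its variance is at most `σ ^ 2`.
  have bend := bE ((N : ℝ≥0) / n) t σ hσ0 (hgrid N le_rfl) (by linarith) (by
    rw [← hσ2]
    refine Real.rpow_le_rpow (abs_nonneg _) ?_ (by linarith)
    have h1 := grid_le (t := t) hn (le_refl N)
    have h2 : (n : ℝ) * t < N + 1 := by exact_mod_cast Nat.lt_floor_add_one ((n : ℝ≥0) * t)
    push_cast
    rw [abs_of_nonneg (by linarith), le_div_iff₀ hn', sub_mul, div_mul_cancel₀ _ hn'.ne']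
    linarith)
  have i₁ := (i₅.abs.const_mul (1 / 2880)).add (i₇.abs.const_mul (1 / 241920))
  have i₂ := i₁.add (i₉.abs.const_mul (1 / 46448640))
  have iS := integrable_finsetSum (Finset.range N) fun j hj => (bstep j hj).1
  have i₃ := i₂.add (iS.const_mul C₁₀)
  have i₄ := i₃.add (bend.1.const_mul C₁)
  -- The dominating function is the right side of the pathwise bound, which holds only almost surely
  -- because `B 0 = 0` does.
  refine ⟨_, i₄, (hB.ae_zero hH).mono fun ω hω =>
    abs_simpsonSum_sub_le hg hε.le h₁ h₁₀ hC₁ hC₁₀ B t n hω, ?_⟩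
  rw [integral_add' i₃ (bend.1.const_mul C₁), integral_add' i₂ (iS.const_mul C₁₀),
    integral_add' i₁ (i₉.abs.const_mul (1 / 46448640)),
    integral_add' (i₅.abs.const_mul (1 / 2880)) (i₇.abs.const_mul (1 / 241920))]
  simp only [integral_const_mul]
  -- The odd sums bring `σ ^ 10`, `σ ^ 14` and `σ ^ 18`; since `σ ≤ 1`, all are controlled by the
  -- first.
  have hσpow : ∀ m : ℕ, 10 ≤ m → (n : ℝ) * σ ^ m ≤ x n := fun m hm =>
    mul_le_mul_of_nonneg_left (pow_le_pow_of_le_one hσ0.le hσ1 hm) hn'.le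
  have hNt : (N : ℝ) ≤ t * n := (div_le_iff₀ hn').1 (grid_le hn le_rfl)
  have hsum : ∫ ω, ∑ j ∈ Finset.range N,
        (Real.exp (ε * B ((j : ℝ≥0) / n) ω ^ 2) +
          Real.exp (ε * B (((j + 1 : ℕ) : ℝ≥0) / n) ω ^ 2)) *
          |B (((j + 1 : ℕ) : ℝ≥0) / n) ω - B ((j : ℝ≥0) / n) ω| ^ 10 ∂P ≤ t * L * x n := by
    rw [integral_finsetSum _ fun j hj => (bstep j hj).1]
    refine (Finset.sum_le_sum fun j hj => (bstep j hj).2).trans ?_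
    rw [Finset.sum_const, Finset.card_range, nsmul_eq_mul]
    calc (N : ℝ) * (L * σ ^ 10) ≤ (t * n) * (L * σ ^ 10) := by gcongr
      _ = _ := by simp only [hx, hσdef]; ring
  have hbend := bend.2
  rw [pow_one] at hbend
  have q₅ := j₅.trans (Real.sqrt_le_sqrt
    (mul_le_mul_of_nonneg_left (hσpow _ (by norm_num)) hK₅))
  have q₇ := j₇.trans (Real.sqrt_le_sqrt
    (mul_le_mul_of_nonneg_left (hσpow _ (by norm_num)) hK₇))
  have q₉ := j₉.trans (Real.sqrt_le_sqrt
    (mul_le_mul_of_nonneg_left (hσpow _ (by norm_num)) hK₉))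
  gcongr
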